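/- Let $\mathcal D$ be a distribution on $\mathbb R^{n}$. Its derived flag is the sequence of modules of vector fields $\mathcal D^{(0)}=\mathcal D$, $\mathcal D^{(i+1)}=\mathcal D^{(i)}+[\mathcal D^{(i)},\mathcal D^{(i)}]$, and its Lie flag is $\mathcal D_{0}=\mathcal D$, $\mathcal D_{i+1}=\mathcal D_{i}+[\mathcal D_{0},\mathcal D_{i}]$; the growth vector at $p$ is the sequence $(\dim\mathcal D_i(p))_{i\ge 0}$. A Goursat structure is a smooth rank two distribution on a manifold of dimension $n\ge3$ with $\dim\mathcal D^{(i)}(p)=i+2$ for all $p$ and $0\le i\le n-2$. For a Goursat structure let $\mathcal C_i$ be the characteristic distribution of $\mathcal D^{(i+1)}$ (generated by the vector fields $f\in\mathcal D^{(i+1)}$ with $[f,\mathcal D^{(i+1)}]\subset\mathcal D^{(i+1)}$), let $S_0^{(i)}=\{p:\mathcal D^{(i)}(p)=\mathcal C_{i+1}(p)\}$ for $0\le i\le n-5$, let $S_j^{(i)}=\{p\in S_{j-1}^{(i)}:\mathcal D^{(i-j)}(p)\cap T_pS_{j-1}^{(i)}\ne\mathcal C_{i-j}(p)\}$ for $1\le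 j\le i$, and let all other $S_j^{(i)}$ be empty. The singularity type of $\mathcal D$ at $p$ is the word $w_{n-4}\cdots w_0$ with $w_i=a_{j+1}$ if $p\in S_j^{(i+j)}$ for some $j\ge0$, and $w_i=a_0$ otherwise. Two distributions are locally equivalent at $0$ if a smooth diffeomorphism between neighbourhoods of $0$ that fixes $0$ carries one to the other. A Kumpera–Ruiz normal form is a pair of vector fields obtained from $\left(\tfrac{\partial}{\partial x_3},\,x_3\tfrac{\partial}{\partial x_2}+\tfrac{\partial}{\partial x_1}\right)$ on $\mathbb R^3$ by finitely many prolongations $(\kappa_1,\kappa_2)\mapsto\left(\tfrac{\partial}{\partial x_{n}},\,(x_{n}+c)\kappa_1+\kappa_2\right)$, with $c\in\mathbb R$, or $(\kappa_1,\kappa_2)\mapsto\left(\tfrac{\partial}{\partial x_{n}},\,\kappa_1+x_{n}\kappa_2\right)$, from $\mathbb R^{n-1}$ to $\mathbb R^{n}$. An abnormal curve of a distribution spanned by a frame $f_1,\dots,f_k$ is an absolutely continuous curve $x:I\to\mathbb R^n$ on an interval that admits a measurable control $u:I\to\mathbb R^k$ and an absolutely continuous, nowhere vanishing covector lift $p$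 such that, with $H(x,p,u)=\langle p,\sum_j u_jf_j(x)\rangle$, one has $\dot x=\partial H/\partial p$, $\dot p=-\partial H/\partial x$ and $\partial H/\partial u=0$ almost everywhere on $I$. **Proposition.** For $c_{11}\in\mathbb R$ let $\mathcal D_{c_{11}}$ be the distribution on $\mathbb R^{11}$ spanned by $\kappa_1=\tfrac{\partial}{\partial x_{11}}$ and $$\kappa_2(c_{11})=(x_{11}+c_{11})\tfrac{\partial}{\partial x_{10}}+(x_{10}+1)\tfrac{\partial}{\partial x_{9}}+(x_{9}+1)\tfrac{\partial}{\partial x_{8}}+x_{8}\tfrac{\partial}{\partial x_{7}}+x_{7}\tfrac{\partial}{\partial x_{6}}+\tfrac{\partial}{\partial x_{5}}+x_{6}\left(x_{5}\tfrac{\partial}{\partial x_{4}}+x_{4}\tfrac{\partial}{\partial x_{3}}+x_{3}\tfrac{\partial}{\partial x_{2}}+\tfrac{\partial}{\partial x_{1}}\right).$$ Each pair $(\kappa_1,\kappa_2(c_{11}))$ is a Kumpera–Ruiz normal form and each $\mathcal D_{c_{11}}$ is a Goursat structure. Two members $\mathcal D_{c}$ and $\mathcal D_{\tilde c}$ of the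 family are locally equivalent at $0$ if and only if $c=\tilde c$. On the other hand, all members have the same singularity type $a_0a_0a_1a_2a_3a_0a_0a_0$ at $0$; all have the same growth vector at $0$; and for any $c,\tilde c$ there is a smooth diffeomorphism between neighbourhoods of $0$ that fixes $0$ and transforms, for every $i\ge0$, the abnormal curves of $\mathcal D_c^{(i)}$ into the abnormal curves of $\mathcal D_{\tilde c}^{(i)}$. -/

import Mathlib

open scoped ContDiff Topology

namespace Goursat

/-! ### Distributions on a finite-dimensional real vector space, modules of vector fields

A distribution is a map `p ↦ D p` into the linear subspaces; vector fields on `E` are functions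
`E → E`, and `[V, W]` is Mathlib's `VectorField.lieBracket`. -/

section Distributions

variable {E : Type*} [NormedAddCommGroup E] [NormedSpace ℝ E]

variable (E) in
/-- The ring of smooth real functions on `E`. -/
def smoothFunctions : Subring (E → ℝ) where
  carrier := {f | ContDiff ℝ ∞ f}
  mul_mem' {f g} hf hg := show ContDiff ℝ ∞ fun x => f x * g x from ContDiff.mul hf hg
  one_mem' := show ContDiff ℝ ∞ fun _ => (1 : ℝ) from contDiff_const
  add_mem' {f g} hf hg := show ContDiff ℝ ∞ fun x => f x + g x from ContDiff.add hf hg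
  zero_mem' := show ContDiff ℝ ∞ fun _ => (0 : ℝ) from contDiff_const
  neg_mem' {f} hf := show ContDiff ℝ ∞ fun x => -f x from ContDiff.neg hf

variable (E) in
/-- Modules of vector fields on `E` over the ring of smooth functions. -/
abbrev VFModule := Submodule (smoothFunctions E) (E → E)

/-- The module of smooth vector fields that are tangent to the distribution `D`. -/
def sections (D : E → Submodule ℝ E) : VFModule E where
  carrier := {V | ContDiff ℝ ∞ V ∧ ∀ x, V x ∈ D x}
  add_mem' hV hW := ⟨ContDiff.add hV.1 hW.1, fun x => (D x).add_mem (hV.2 x) (hW.2 x)⟩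
  zero_mem' := ⟨contDiff_const, fun x => (D x).zero_mem⟩
  smul_mem' f _ hV := ⟨ContDiff.smul f.2 hV.1, fun x => (D x).smul_mem _ (hV.2 x)⟩

/-- The module generated by all brackets `[V, W]` with `V ∈ M` and `W ∈ N`. -/
def bracket (M N : VFModule E) : VFModule E :=
  Submodule.span (smoothFunctions E)
    {Z | ∃ V ∈ M, ∃ W ∈ N, Z = VectorField.lieBracket ℝ V W}

/-- The subspace of values at the point `p` of the vector fields in `M`. -/
def valuesAt (M : VFModule E) (p : E) : Submodule ℝ E :=
  Submodule.span ℝ {v | ∃ V ∈ M, V p = v}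

/-- The derived flag: `D⁽⁰⁾ = D`, `D⁽ⁱ⁺¹⁾ = D⁽ⁱ⁾ + [D⁽ⁱ⁾, D⁽ⁱ⁾]`. -/
def derivedFlag (D : E → Submodule ℝ E) : ℕ → VFModule E
  | 0 => sections D
  | i + 1 => derivedFlag D i ⊔ bracket (derivedFlag D i) (derivedFlag D i)

/-- The distribution `p ↦ D⁽ⁱ⁾(p)`. -/
def derivedDist (D : E → Submodule ℝ E) (i : ℕ) (p : E) : Submodule ℝ E :=
  valuesAt (derivedFlag D i) p

/-- The Lie flag: `D_0 = D`, `D_{i+1} = D_i + [D_0, D_i]`. -/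
def lieFlag (D : E → Submodule ℝ E) : ℕ → VFModule E
  | 0 => sections D
  | i + 1 => lieFlag D i ⊔ bracket (sections D) (lieFlag D i)

/-- The growth vector of `D` at `p`: the sequence `i ↦ dim D_i(p)`. -/
noncomputable def growthVector (D : E → Submodule ℝ E) (p : E) (i : ℕ) : ℕ :=
  Module.finrank ℝ (valuesAt (lieFlag D i) p)

/-- `D` is a smooth distribution of rank `k`. -/
def IsSmoothDistribution (k : ℕ) (D : E → Submodule ℝ E) : Prop :=
  ∀ p, ∃ U : Set E, IsOpen U ∧ p ∈ U ∧ ∃ f : Fin k → E → E,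
    (∀ j, ContDiffOn ℝ ∞ (f j) U) ∧
    ∀ x ∈ U, LinearIndependent ℝ (fun j => f j x) ∧
      Submodule.span ℝ (Set.range fun j => f j x) = D x

/-- A Goursat structure on `E`, `dim E = n ≥ 3`: a rank two distribution
with `dim D⁽ⁱ⁾(p) = i + 2` for `0 ≤ i ≤ n - 2` and all `p`. -/
def IsGoursat (D : E → Submodule ℝ E) : Prop :=
  3 ≤ Module.finrank ℝ E ∧ IsSmoothDistribution 2 D ∧
    ∀ i, i + 2 ≤ Module.finrank ℝ E → ∀ p, Module.finrank ℝ (derivedDist D i p) = i + 2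

/-- `D` at `p` and `D'` at `p'` are locally equivalent: a smooth diffeomorphism between
neighbourhoods of `p` and `p'` takes `p` to `p'` and pushes `D` forward to `D'`. -/
def LocallyEquivalent (D : E → Submodule ℝ E) (p : E) (D' : E → Submodule ℝ E) (p' : E) : Prop :=
  ∃ φ : OpenPartialHomeomorph E E, p ∈ φ.source ∧ φ p = p' ∧
    ContDiffOn ℝ ∞ φ φ.source ∧ ContDiffOn ℝ ∞ φ.symm φ.target ∧
    ∀ x ∈ φ.source, (D x).map (fderiv ℝ φ x : E →ₗ[ℝ] E) = D' (φ x)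

/-! ### The singularity type -/

/-- The characteristic distribution of `M`: the module generated by all `V ∈ M`
with `[V, M] ⊆ M`. -/
def characteristic (M : VFModule E) : VFModule E :=
  Submodule.span (smoothFunctions E)
    {V | V ∈ M ∧ ∀ W ∈ M, VectorField.lieBracket ℝ V W ∈ M}

/-- `C_i(p)`, where `C_i` is the characteristic distribution of `D⁽ⁱ⁺¹⁾`. -/
def charDist (D : E → Submodule ℝ E) (i : ℕ) (p : E) : Submodule ℝ E :=
  valuesAt (characteristic (derivedFlag D (i + 1))) p

/-- Tangent vectors at `p` of a submanifold `S`: velocities at `p` of smooth curves in `S`. -/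
def tangentVectors (S : Set E) (p : E) : Set E :=
  {v | ∃ γ : ℝ → E, ContDiff ℝ ∞ γ ∧ γ 0 = p ∧ (∀ᶠ t in 𝓝 0, γ t ∈ S) ∧ deriv γ 0 = v}

/-- The canonical submanifolds: `singularSet D i j` is `S_j⁽ⁱ⁾`. For `0 ≤ i ≤ n - 5`,
`S_0⁽ⁱ⁾ = {p | D⁽ⁱ⁾(p) = C_{i+1}(p)}`, and for `1 ≤ j ≤ i`,
`S_j⁽ⁱ⁾ = {p ∈ S_{j-1}⁽ⁱ⁾ | D⁽ⁱ⁻ʲ⁾(p) ∩ T_p S_{j-1}⁽ⁱ⁾ ≠ C_{i-j}(p)}`;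
all others are empty. -/
def singularSet (D : E → Submodule ℝ E) (i : ℕ) : ℕ → Set E
  | 0 => {p | i + 5 ≤ Module.finrank ℝ E ∧ derivedDist D i p = charDist D (i + 1) p}
  | j + 1 => {p | j + 1 ≤ i ∧ p ∈ singularSet D i j ∧
      (derivedDist D (i - (j + 1)) p : Set E) ∩ tangentVectors (singularSet D i j) p ≠
        (charDist D (i - (j + 1)) p : Set E)}

open Classical in
/-- The index of the letter `w_i`: it is `j + 1` if `p ∈ S_j⁽ⁱ⁺ʲ⁾` for some `j`
(for a Goursat structure there is at most one such `j`), and `0` otherwise. -/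
noncomputable def singularityLetter (D : E → Submodule ℝ E) (p : E) (i : ℕ) : ℕ :=
  if h : ∃ j, p ∈ singularSet D (i + j) j then Nat.find h + 1 else 0

/-- The singularity type `w_{n-4} ⋯ w_0` of `D` at `p`, with the letter `a_k` written as `k`. -/
noncomputable def singularityType (D : E → Submodule ℝ E) (p : E) : List ℕ :=
  (List.range (Module.finrank ℝ E - 3)).reverse.map (singularityLetter D p)

/-! ### Abnormal curves -/

/-- A global smooth frame of `D`. -/
def IsFrame {k : ℕ} (f : Fin k → E → E) (D : E → Submodule ℝ E) : Prop :=
  (∀ j, ContDiff ℝ ∞ (f j)) ∧ ∀ x, LinearIndependent ℝ (fun j => f j x) ∧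
    Submodule.span ℝ (Set.range fun j => f j x) = D x

/-- The Hamiltonian `H(x, p, u) = ⟨p, ∑ u_j f_j(x)⟩` of a control system. -/
def hamiltonian {k : ℕ} (f : Fin k → E → E) (x : E) (p : E →L[ℝ] ℝ) (u : Fin k → ℝ) : ℝ :=
  p (∑ j, u j • f j x)

/-- Absolute continuity on an interval `I` (on each compact subinterval). -/
def IsAC {F : Type*} [NormedAddCommGroup F] (x : ℝ → F) (I : Set ℝ) : Prop :=
  ∀ a ∈ I, ∀ b ∈ I, AbsolutelyContinuousOnInterval x a b

/-- The curve `x`, restricted to the interval `I`, is an abnormal curve of `D`: for a frame `f` of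
`D` and a measurable control `u`, it has a nowhere zero absolutely continuous lift `p` with
`ẋ = ∂H/∂p`, `ṗ = -∂H/∂x` and `∂H/∂u = 0` almost everywhere on `I`. -/
def IsAbnormal (D : E → Submodule ℝ E) (I : Set ℝ) (x : ℝ → E) : Prop :=
  IsAC x I ∧ ∃ (k : ℕ) (f : Fin k → E → E) (u : ℝ → Fin k → ℝ) (p : ℝ → E →L[ℝ] ℝ),
    IsFrame f D ∧ Measurable u ∧ IsAC p I ∧ (∀ t ∈ I, p t ≠ 0) ∧
    ∀ᵐ t, t ∈ I →
      HasDerivAt x (∑ j, u t j • f j (x t)) t ∧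
      HasDerivAt p (-fderiv ℝ (fun y => hamiltonian f y (p t) (u t)) (x t)) t ∧
      fderiv ℝ (fun v => hamiltonian f (x t) (p t) v) (u t) = 0

/-- A smooth diffeomorphism between neighbourhoods of `p` and `p'` takes `p` to `p'` and transforms,
for every `i ≥ 0`, the abnormal curves of `D⁽ⁱ⁾` into those of `D'⁽ⁱ⁾`. -/
def SameAbnormals (D : E → Submodule ℝ E) (p : E) (D' : E → Submodule ℝ E) (p' : E) : Prop :=
  ∃ φ : OpenPartialHomeomorph E E, p ∈ φ.source ∧ φ p = p' ∧
    ContDiffOn ℝ ∞ φ φ.source ∧ ContDiffOn ℝ ∞ φ.symm φ.target ∧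
    ∀ (i : ℕ) (I : Set ℝ) (x : ℝ → E), I.OrdConnected → (∀ t ∈ I, x t ∈ φ.source) →
      (IsAbnormal (derivedDist D i) I x ↔ IsAbnormal (derivedDist D' i) I (φ ∘ x))

end Distributions

/-! ### Kumpera-Ruiz normal forms

The coordinate `x_k` (`1 ≤ k ≤ n`) is `x (k - 1)`. -/

/-- Vector fields on `ℝⁿ`. -/
abbrev VF (n : ℕ) := (Fin n → ℝ) → (Fin n → ℝ)

/-- The lift of a vector field from `ℝⁿ` to `ℝⁿ⁺¹`, along the last coordinate. -/
def lift {n : ℕ} (f : VF n) : VF (n + 1) := fun x =>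
  Fin.snoc (α := fun _ => ℝ) (f (Fin.init x)) 0

/-- The vector field `∂/∂x_{n+1}` on `ℝⁿ⁺¹`. -/
def lastField (n : ℕ) : VF (n + 1) := fun _ => Pi.single (Fin.last n) 1

/-- The pair `(κ₁, κ₂)` on `ℝⁿ` is a Kumpera-Ruiz normal form: it is obtained from the
Pfaff-Darboux pair on `ℝ³` by regular and singular prolongations. -/
inductive IsKumperaRuiz : (n : ℕ) → VF n → VF n → Prop
  | base : IsKumperaRuiz 3 (fun _ => ![0, 0, 1]) (fun x => ![1, x 2, 0])
  | regular {n : ℕ} {κ₁ κ₂ : VF n} (h : IsKumperaRuiz n κ₁ κ₂) (c : ℝ) :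
      IsKumperaRuiz (n + 1) (lastField n)
        (fun x => (x (Fin.last n) + c) • lift κ₁ x + lift κ₂ x)
  | singular {n : ℕ} {κ₁ κ₂ : VF n} (h : IsKumperaRuiz n κ₁ κ₂) :
      IsKumperaRuiz (n + 1) (lastField n)
        (fun x => lift κ₁ x + x (Fin.last n) • lift κ₂ x)

/-- `κ₁ = ∂/∂x₁₁`. -/
def kr₁ : VF 11 := fun _ => ![0, 0, 0, 0, 0, 0, 0, 0, 0, 0, 1]

/-- `κ₂(c) = (x₁₁ + c) ∂₁₀ + (x₁₀ + 1) ∂₉ + (x₉ + 1) ∂₈ + x₈ ∂₇ + x₇ ∂₆ + ∂₅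
  + x₆ (x₅ ∂₄ + x₄ ∂₃ + x₃ ∂₂ + ∂₁)`. -/
def kr₂ (c : ℝ) : VF 11 := fun x =>
  ![x 5, x 5 * x 2, x 5 * x 3, x 5 * x 4, 1, x 6, x 7, x 8 + 1, x 9 + 1, x 10 + c, 0]

/-- The distribution on `ℝ¹¹` spanned by `κ₁` and `κ₂(c)`. -/
def krDist (c : ℝ) (x : Fin 11 → ℝ) : Submodule ℝ (Fin 11 → ℝ) :=
  Submodule.span ℝ {kr₁ x, kr₂ c x}

end Goursat

namespace Goursat

/-! ### Modules of vector fields: generators, values, brackets, characteristic fields. -/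

section Modules

variable {E : Type*} [NormedAddCommGroup E] [NormedSpace ℝ E]

/-! Indices start at 0, as in the code. Put K = ∂0 + x2∂1 + x3∂2 + x4∂3, which is `flagField c 6`;
then κ₂ = x5 K + ∂4 + x6∂5 + x7∂6 + (x8+1)∂7 + (x9+1)∂8 + (x10+c)∂9. For i ≤ 9 the derived module
D⁽ⁱ⁾ is generated by `flagField c i` and the ∂j with j ≥ 10 - i (`derivedFlag_krDist`), and for i ≤
7 its characteristic companion C_i is generated by the same ∂j alone (`characteristic_krDist`). The
ranks follow, and so does the singularity type: the only canonical hypersurface is {x5 = 0}, over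
which lie {x5 = x6 = 0} and {x5 = x6 = x7 = 0}; the next step would need x8 = -1, so it avoids the
origin.

The Lie flag coincides with the derived flag up to index 7. Beyond that, the new directions come
from iterated brackets of κ₂ with ∂3, computed explicitly in `growthField`. At the origin the
parameter occurs only in a direction that is already present, so the growth vector does not see it.

For i ≥ 1 the module D⁽ⁱ⁾ does not depend on c at all. For i = 0 and x8 > -1, a cascade of almost
everywhere vanishing covector components shows that abnormal curves are tangent to ∂10
(`ae_deriv_eq_zero_of_isAbnormal`), and every such absolutely continuous curve is abnormal for every
parameter. The identity on that half space therefore matches all abnormal curves.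

The invariance of c is the main point. An equivalence φ pulls back the Pfaffian equations of the
target to equations valid on the derived flag of the source (`MapsKr.pfaff_of_mem_derivedFlag`).
Characteristic directions then show that φ0 depends to first order only on x0, x1, x2 and φ3 only on
x0, ..., x3. Along the integral curve of κ₂ through 0, where x5 = t³/6 + t⁴/24 + c t⁵/120, these
facts make Kφ0 and the speed δ of φ4 constant up to O(t³), say G₀ and δ₀. The identity φ5 δ = x5 ·
Kφ0 then gives, in orders 3, 4 and 5, δ₀⁴ = G₀, δ₀⁵ = G₀ and c'δ₀⁶ = cG₀. As G₀ ≠ 0, both constants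
are 1 and c = c' (`parameter_eq_of_tower`, `MapsKr.parameter_eq`). -/

theorem differentiableAt_smoothFunctions (f : smoothFunctions E) (x : E) :
    DifferentiableAt ℝ f.1 x :=
  (show ContDiff ℝ ∞ f.1 from f.2).contDiffAt.differentiableAt (by simp)

theorem contDiff_of_mem_span {S : Set (E → E)} (hS : ∀ V ∈ S, ContDiff ℝ ∞ V) {V : E → E}
    (hV : V ∈ Submodule.span (smoothFunctions E) S) : ContDiff ℝ ∞ V := by
  induction hV using Submodule.span_induction with
  | mem V hV => exact hS V hV
  | zero => exact contDiff_const
  | add V W _ _ hV hW => exact hV.add hW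
  | smul f V _ hV => exact ContDiff.smul f.2 hV

theorem apply_mem_span {S : Set (E → E)} {V : E → E} (p : E)
    (hV : V ∈ Submodule.span (smoothFunctions E) S) :
    V p ∈ Submodule.span ℝ ((fun W : E → E => W p) '' S) := by
  induction hV using Submodule.span_induction with
  | mem V hV => exact Submodule.subset_span ⟨V, hV, rfl⟩
  | zero => exact Submodule.zero_mem _
  | add V W _ _ hV hW => exact Submodule.add_mem _ hV hW
  | smul f V _ hV => exact Submodule.smul_mem _ _ hV

theorem valuesAt_span (S : Set (E → E)) (p : E) :
    valuesAt (Submodule.span (smoothFunctions E) S) p =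
      Submodule.span ℝ ((fun W : E → E => W p) '' S) := by
  apply le_antisymm
  · rw [valuesAt, Submodule.span_le]
    rintro _ ⟨V, hV, rfl⟩
    exact apply_mem_span p hV
  · rw [Submodule.span_le]
    rintro _ ⟨V, hV, rfl⟩
    exact Submodule.subset_span ⟨V, Submodule.subset_span hV, rfl⟩

theorem apply_mem_valuesAt {M : VFModule E} {V : E → E} (hV : V ∈ M) (p : E) :
    V p ∈ valuesAt M p :=
  Submodule.subset_span ⟨V, hV, rfl⟩

theorem valuesAt_mono {M N : VFModule E} (h : M ≤ N) (p : E) : valuesAt M p ≤ valuesAt N p := by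
  apply Submodule.span_mono
  rintro _ ⟨V, hV, rfl⟩
  exact ⟨V, h hV, rfl⟩

theorem mul_mem_module {M : VFModule E} {f : E → ℝ} (hf : ContDiff ℝ ∞ f) {V : E → E}
    (hV : V ∈ M) : (fun x => f x • V x) ∈ M :=
  M.smul_mem (⟨f, hf⟩ : smoothFunctions E) hV

theorem contDiff_fderiv_apply {f : E → ℝ} (hf : ContDiff ℝ ∞ f) {V : E → E}
    (hV : ContDiff ℝ ∞ V) : ContDiff ℝ ∞ fun x => fderiv ℝ f x (V x) :=
  (hf.fderiv_right (m := ∞) (by simp)).clm_apply hV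

/-- By the Leibniz rule, brackets of combinations differ from combinations of brackets by multiples
of the generators themselves. Hence both generating sets must lie in `N`, and only brackets of
generators need checking. -/
theorem lieBracket_mem_of_mem_span {S T : Set (E → E)} (hS : ∀ V ∈ S, ContDiff ℝ ∞ V)
    (hT : ∀ V ∈ T, ContDiff ℝ ∞ V) {N : VFModule E}
    (hSN : S ⊆ N) (hTN : T ⊆ N)
    (h : ∀ V ∈ T, ∀ W ∈ S, VectorField.lieBracket ℝ V W ∈ N) {V W : E → E}
    (hV : V ∈ Submodule.span (smoothFunctions E) T)
    (hW : W ∈ Submodule.span (smoothFunctions E) S) :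
    VectorField.lieBracket ℝ V W ∈ N := by
  have hd : ∀ {V : E → E}, ContDiff ℝ ∞ V → ∀ x, DifferentiableAt ℝ V x := fun hV x =>
    (hV.differentiable (by simp)).differentiableAt
  have hSN' := Submodule.span_le.2 hSN
  have hTN' := Submodule.span_le.2 hTN
  induction hV using Submodule.span_induction with
  | mem V hV =>
    induction hW using Submodule.span_induction with
    | mem W hW => exact h V hV W hW
    | zero => simp
    | add W₁ W₂ h₁ h₂ ih₁ ih₂ =>
      have : VectorField.lieBracket ℝ V (W₁ + W₂) =
          VectorField.lieBracket ℝ V W₁ + VectorField.lieBracket ℝ V W₂ := by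
        ext1 x
        exact VectorField.lieBracket_add_right (hd (contDiff_of_mem_span hS h₁) x)
          (hd (contDiff_of_mem_span hS h₂) x)
      rw [this]
      exact N.add_mem ih₁ ih₂
    | smul f W hW ih =>
      have : VectorField.lieBracket ℝ V (f • W) =
          (fun x => (fderiv ℝ f.1 x (V x)) • W x) + f • VectorField.lieBracket ℝ V W := by
        ext1 x
        exact VectorField.lieBracket_smul_right (differentiableAt_smoothFunctions f x)
          (hd (contDiff_of_mem_span hS hW) x)
      rw [this]
      exact N.add_mem (mul_mem_module (contDiff_fderiv_apply f.2 (hT V hV)) (hSN' hW))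
        (N.smul_mem _ ih)
  | zero => simp
  | add V₁ V₂ h₁ h₂ ih₁ ih₂ =>
    have : VectorField.lieBracket ℝ (V₁ + V₂) W =
        VectorField.lieBracket ℝ V₁ W + VectorField.lieBracket ℝ V₂ W := by
      ext1 x
      exact VectorField.lieBracket_add_left (hd (contDiff_of_mem_span hT h₁) x)
        (hd (contDiff_of_mem_span hT h₂) x)
    rw [this]
    exact N.add_mem ih₁ ih₂
  | smul f V hV ih =>
    have : VectorField.lieBracket ℝ (f • V) W =
        -(fun x => (fderiv ℝ f.1 x (W x)) • V x) + f • VectorField.lieBracket ℝ V W := by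
      ext1 x
      have := VectorField.lieBracket_smul_left (W := W) (differentiableAt_smoothFunctions f x)
          (hd (contDiff_of_mem_span hT hV) x)
      rw [neg_smul] at this
      exact this
    rw [this]
    exact N.add_mem (N.neg_mem (mul_mem_module
      (contDiff_fderiv_apply f.2 (contDiff_of_mem_span hS hW)) (hTN' hV))) (N.smul_mem _ ih)

theorem span_sup_bracket_span {S T R : Set (E → E)} (hS : ∀ V ∈ S, ContDiff ℝ ∞ V)
    (hT : ∀ V ∈ T, ContDiff ℝ ∞ V)
    (hSR : S ⊆ Submodule.span (smoothFunctions E) R)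
    (hTR : T ⊆ Submodule.span (smoothFunctions E) R)
    (h : ∀ V ∈ T, ∀ W ∈ S, VectorField.lieBracket ℝ V W ∈ Submodule.span (smoothFunctions E) R)
    (hR : R ⊆ (Submodule.span (smoothFunctions E) S ⊔
      bracket (Submodule.span (smoothFunctions E) T) (Submodule.span (smoothFunctions E) S) :
        VFModule E)) :
    Submodule.span (smoothFunctions E) S ⊔
      bracket (Submodule.span (smoothFunctions E) T) (Submodule.span (smoothFunctions E) S) =
    Submodule.span (smoothFunctions E) R := by
  refine le_antisymm (sup_le (Submodule.span_le.2 hSR) (Submodule.span_le.2 ?_))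
    (Submodule.span_le.2 hR)
  rintro _ ⟨V, hV, W, hW, rfl⟩
  exact lieBracket_mem_of_mem_span hS hT hSR hTR h hV hW

/-- The characteristic distribution of `C + ⟨X, Y⟩`, when `C` is made of characteristic fields and
the bracket `[X, Y]` is nowhere tangent. -/
theorem characteristic_span_insert {S : Set (E → E)} {X Y : E → E}
    (hS : ∀ V ∈ S, ContDiff ℝ ∞ V) (hX : ContDiff ℝ ∞ X) (hY : ContDiff ℝ ∞ Y)
    (hchar : ∀ V ∈ S, ∀ W ∈ insert X (insert Y S), VectorField.lieBracket ℝ V W ∈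
      Submodule.span (smoothFunctions E) (insert X (insert Y S)))
    (hXY : ∀ p, VectorField.lieBracket ℝ X Y p ∉
      Submodule.span ℝ ((fun W : E → E => W p) '' insert X (insert Y S))) :
    characteristic (Submodule.span (smoothFunctions E) (insert X (insert Y S))) =
      Submodule.span (smoothFunctions E) S := by
  set M := Submodule.span (smoothFunctions E) (insert X (insert Y S)) with hM
  have hsm : ∀ V ∈ insert X (insert Y S), ContDiff ℝ ∞ V := by
    rintro V (rfl | rfl | hV)
    exacts [hX, hY, hS V hV]
  have hXM : X ∈ M := Submodule.subset_span (by simp)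
  have hYM : Y ∈ M := Submodule.subset_span (by simp)
  have hSM : S ⊆ M := fun V hV => Submodule.subset_span (by simp [hV])
  have hCM := Submodule.span_le.2 hSM
  have hd : ∀ {V : E → E}, V ∈ M → ∀ x, DifferentiableAt ℝ V x := fun hV x =>
    ((contDiff_of_mem_span hsm hV).differentiable (by simp)).differentiableAt
  have hcl : ∀ V ∈ Submodule.span (smoothFunctions E) S, ∀ W ∈ M,
      VectorField.lieBracket ℝ V W ∈ M := fun V hV W hW =>
    lieBracket_mem_of_mem_span hsm hS Submodule.subset_span hSM hchar hV hW
  apply le_antisymm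
  · rw [characteristic, Submodule.span_le]
    rintro V ⟨hV, hVM⟩
    obtain ⟨f, U, hU, rfl⟩ := Submodule.mem_span_insert.1 hV
    obtain ⟨g, Z, hZ, rfl⟩ := Submodule.mem_span_insert.1 hU
    -- The terms of [fX + gY + Z, W] that differentiate f or g, and the bracket with Z, already take
    -- values in the module. Taking W = Y and W = X then isolates f and g as coefficients of the
    -- transversal bracket.
    have key : ∀ W ∈ M, ∀ p, f.1 p • VectorField.lieBracket ℝ X W p
        + g.1 p • VectorField.lieBracket ℝ Y W p ∈
        Submodule.span ℝ ((fun W : E → E => W p) '' insert X (insert Y S)) := by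
      intro W hW p
      have h1 := apply_mem_span p (hVM W hW)
      have h2 := apply_mem_span p (hcl Z hZ W hW)
      have e : VectorField.lieBracket ℝ (f • X + (g • Y + Z)) W p =
          (-(fderiv ℝ f.1 p (W p)) • X p + f.1 p • VectorField.lieBracket ℝ X W p) +
          ((-(fderiv ℝ g.1 p (W p)) • Y p + g.1 p • VectorField.lieBracket ℝ Y W p) +
            VectorField.lieBracket ℝ Z W p) := by
        rw [VectorField.lieBracket_add_left, VectorField.lieBracket_add_left]
        · congr 1
          · exact VectorField.lieBracket_smul_left (differentiableAt_smoothFunctions f p) (hd hXM p)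
          · congr 1
            exact VectorField.lieBracket_smul_left (differentiableAt_smoothFunctions g p) (hd hYM p)
        · exact hd (M.smul_mem _ hYM) p
        · exact hd (hCM hZ) p
        · exact hd (M.smul_mem _ hXM) p
        · exact hd (M.add_mem (M.smul_mem _ hYM) (hCM hZ)) p
      rw [e] at h1
      have h3 := Submodule.add_mem _ (Submodule.smul_mem _ (fderiv ℝ f.1 p (W p))
        (apply_mem_span p hXM)) (Submodule.smul_mem _ (fderiv ℝ g.1 p (W p))
        (apply_mem_span p hYM))
      convert Submodule.add_mem _ (Submodule.sub_mem _ h1 h2) h3 using 1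
      module
    have hf : f = 0 := by
      ext p
      by_contra hp
      have h := key Y hYM p
      rw [VectorField.lieBracket_self, Pi.zero_apply, smul_zero, add_zero] at h
      exact hXY p ((Submodule.smul_mem_iff _ hp).1 h)
    have hg : g = 0 := by
      ext p
      by_contra hp
      have h := key X hXM p
      rw [VectorField.lieBracket_self, Pi.zero_apply, smul_zero, zero_add,
        VectorField.lieBracket_swap, smul_neg, Submodule.neg_mem_iff] at h
      exact hXY p ((Submodule.smul_mem_iff _ hp).1 h)
    simpa [hf, hg] using hZ
  · refine Submodule.span_mono fun V hV => ⟨hSM hV, fun W hW => hcl V (Submodule.subset_span hV) W hW⟩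

end Modules

/-! ### The derived flag of the family -/

/-- The coordinate vector field `∂/∂x_{j+1}`. -/
def coordField (j : Fin 11) : VF 11 := fun _ => Pi.single j 1

/-- The transversal generator of the `i`-th derived distribution, modulo coordinate fields. -/
def flagField (c : ℝ) : ℕ → VF 11
  | 6 => fun x => ![1, x 2, x 3, x 4, 0, 0, 0, 0, 0, 0, 0]
  | 7 => fun x => ![1, x 2, x 3, 0, 0, 0, 0, 0, 0, 0, 0]
  | 8 => fun x => ![1, x 2, 0, 0, 0, 0, 0, 0, 0, 0, 0]
  | 9 => fun _ => ![1, 0, 0, 0, 0, 0, 0, 0, 0, 0, 0]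
  | _ => kr₂ c

/-- The coordinate fields `∂/∂x_{j+1}` with `m ≤ j`. -/
def lastCoordFields (m : ℕ) : Set (VF 11) := {V | ∃ j : Fin 11, m ≤ j ∧ V = coordField j}

/-- Generators of the `i`-th derived module. -/
def flagGens (c : ℝ) (i : ℕ) : Set (VF 11) := insert (flagField c i) (lastCoordFields (10 - i))

theorem coordField_mem {m : ℕ} {j : Fin 11} (h : m ≤ j) : coordField j ∈ lastCoordFields m :=
  ⟨j, h, rfl⟩

theorem contDiff_coordField (j : Fin 11) : ContDiff ℝ ∞ (coordField j) := contDiff_const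

theorem contDiff_of_mem_lastCoordFields {m : ℕ} : ∀ V ∈ lastCoordFields m, ContDiff ℝ ∞ V := by
  rintro _ ⟨j, -, rfl⟩
  exact contDiff_coordField j

theorem contDiff_kr₂ (c : ℝ) : ContDiff ℝ ∞ (kr₂ c) := by
  rw [contDiff_pi]
  intro m
  fin_cases m <;> simp [kr₂] <;> fun_prop

theorem contDiff_flagField (c : ℝ) (i : ℕ) : ContDiff ℝ ∞ (flagField c i) := by
  unfold flagField
  split
  on_goal 5 => exact contDiff_kr₂ c
  all_goals
    rw [contDiff_pi]
    intro m
    fin_cases m <;> simp <;> fun_prop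

theorem contDiff_of_mem_flagGens {c : ℝ} {i : ℕ} : ∀ V ∈ flagGens c i, ContDiff ℝ ∞ V := by
  rintro V (rfl | hV)
  exacts [contDiff_flagField c i, contDiff_of_mem_lastCoordFields V hV]

theorem hasFDerivAt_coord (x : Fin 11 → ℝ) (j : Fin 11) :
    HasFDerivAt (fun y : Fin 11 → ℝ => y j)
      (ContinuousLinearMap.proj (R := ℝ) (φ := fun _ : Fin 11 => ℝ) j) x :=
  (ContinuousLinearMap.proj (R := ℝ) (φ := fun _ : Fin 11 => ℝ) j).hasFDerivAt

theorem fderiv_pi_apply {V : VF 11} {x : Fin 11 → ℝ} (hV : DifferentiableAt ℝ V x)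
    (v : Fin 11 → ℝ) (m : Fin 11) : fderiv ℝ V x v m = fderiv ℝ (fun y => V y m) x v := by
  rw [fderiv_pi (fun i => (differentiableAt_pi.1 hV) i)]
  rfl

theorem fderiv_coord (x v : Fin 11 → ℝ) (j : Fin 11) :
    fderiv ℝ (fun y : Fin 11 → ℝ => y j) x v = v j := by
  rw [(hasFDerivAt_coord x j).fderiv]
  rfl

theorem fderiv_kr₂ (c : ℝ) (x v : Fin 11 → ℝ) :
    fderiv ℝ (kr₂ c) x v =
      ![v 5, v 5 * x 2 + x 5 * v 2, v 5 * x 3 + x 5 * v 3, v 5 * x 4 + x 5 * v 4, 0, v 6, v 7,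
        v 8, v 9, v 10, 0] := by
  have hd : DifferentiableAt ℝ (kr₂ c) x := (contDiff_kr₂ c).contDiffAt.differentiableAt (by simp)
  have hc := fun j => (hasFDerivAt_coord x j).differentiableAt
  ext m
  rw [fderiv_pi_apply hd]
  fin_cases m <;> simp [kr₂, fderiv_fun_mul, hc, fderiv_coord] <;> ring

theorem fderiv_flagField_six (c : ℝ) (x v : Fin 11 → ℝ) :
    fderiv ℝ (flagField c 6) x v = ![0, v 2, v 3, v 4, 0, 0, 0, 0, 0, 0, 0] := by
  have hd : DifferentiableAt ℝ (flagField c 6) x :=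
    (contDiff_flagField c 6).contDiffAt.differentiableAt (by simp)
  ext m
  rw [fderiv_pi_apply hd]
  fin_cases m <;> simp [flagField, fderiv_coord]

theorem fderiv_flagField_seven (c : ℝ) (x v : Fin 11 → ℝ) :
    fderiv ℝ (flagField c 7) x v = ![0, v 2, v 3, 0, 0, 0, 0, 0, 0, 0, 0] := by
  have hd : DifferentiableAt ℝ (flagField c 7) x :=
    (contDiff_flagField c 7).contDiffAt.differentiableAt (by simp)
  ext m
  rw [fderiv_pi_apply hd]
  fin_cases m <;> simp [flagField, fderiv_coord]

theorem fderiv_flagField_eight (c : ℝ) (x v : Fin 11 → ℝ) :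
    fderiv ℝ (flagField c 8) x v = ![0, v 2, 0, 0, 0, 0, 0, 0, 0, 0, 0] := by
  have hd : DifferentiableAt ℝ (flagField c 8) x :=
    (contDiff_flagField c 8).contDiffAt.differentiableAt (by simp)
  ext m
  rw [fderiv_pi_apply hd]
  fin_cases m <;> simp [flagField, fderiv_coord]

theorem fderiv_coordField (j : Fin 11) (x : Fin 11 → ℝ) : fderiv ℝ (coordField j) x = 0 :=
  fderiv_const_apply _

theorem lieBracket_coordField_left (j : Fin 11) (V : VF 11) :
    VectorField.lieBracket ℝ (coordField j) V = fun x => fderiv ℝ V x (Pi.single j 1) := by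
  ext1 x
  simp [VectorField.lieBracket, fderiv_coordField, coordField]

theorem lieBracket_coordField_coordField (j k : Fin 11) :
    VectorField.lieBracket ℝ (coordField j) (coordField k) = 0 := by
  rw [lieBracket_coordField_left]
  ext1 x
  simp [fderiv_coordField]

/-- The field added to the `i`-th derived module by the next bracket. -/
def flagBracket (c : ℝ) : ℕ → VF 11
  | 0 => coordField 9
  | 1 => coordField 8
  | 2 => coordField 7
  | 3 => coordField 6
  | 4 => coordField 5
  | 5 => flagField c 6
  | 6 => coordField 3
  | 7 => coordField 2
  | _ => coordField 1

theorem flagField_of_le (c : ℝ) {i : ℕ} (hi : i ≤ 5) : flagField c i = kr₂ c := by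
  interval_cases i <;> rfl

theorem lieBracket_coordField_kr₂ (c : ℝ) {j : Fin 11} (hj : 5 ≤ j) :
    VectorField.lieBracket ℝ (coordField j) (kr₂ c) = flagBracket c (10 - j) := by
  rw [lieBracket_coordField_left]
  ext x m
  rw [fderiv_kr₂]
  fin_cases j <;> simp at hj <;> fin_cases m <;> simp [flagBracket, coordField, flagField]

theorem lieBracket_coordField_six (c : ℝ) {j : Fin 11} (hj : 4 ≤ j) :
    VectorField.lieBracket ℝ (coordField j) (flagField c 6) =
      if j = 4 then coordField 3 else 0 := by
  rw [lieBracket_coordField_left]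
  ext x m
  rw [fderiv_flagField_six]
  fin_cases j <;> simp at hj <;> fin_cases m <;> simp [coordField]

theorem lieBracket_coordField_seven (c : ℝ) {j : Fin 11} (hj : 3 ≤ j) :
    VectorField.lieBracket ℝ (coordField j) (flagField c 7) =
      if j = 3 then coordField 2 else 0 := by
  rw [lieBracket_coordField_left]
  ext x m
  rw [fderiv_flagField_seven]
  fin_cases j <;> simp at hj <;> fin_cases m <;> simp [coordField]

theorem lieBracket_coordField_eight (c : ℝ) {j : Fin 11} (hj : 2 ≤ j) :
    VectorField.lieBracket ℝ (coordField j) (flagField c 8) =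
      if j = 2 then coordField 1 else 0 := by
  rw [lieBracket_coordField_left]
  ext x m
  rw [fderiv_flagField_eight]
  fin_cases j <;> simp at hj <;> fin_cases m <;> simp [coordField]

/-- Subtracting fK leaves only components along the ∂j with j ≥ m, with smooth coefficients. This
reduces membership in a module of the flag to a comparison of the first m coordinates. -/
theorem mem_of_eq_mul {N : VFModule (Fin 11 → ℝ)} {m : ℕ} {K V : VF 11} {f : (Fin 11 → ℝ) → ℝ}
    (hK : K ∈ N) (he : lastCoordFields m ⊆ N) (hKs : ContDiff ℝ ∞ K) (hV : ContDiff ℝ ∞ V)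
    (hf : ContDiff ℝ ∞ f) (h : ∀ x (j : Fin 11), (j : ℕ) < m → V x j = f x * K x j) : V ∈ N := by
  have e : V = (fun x => f x • K x) + ∑ j : Fin 11, if m ≤ (j : ℕ) then
      (fun x => (V x j - f x * K x j) • coordField j x) else 0 := by
    ext x i
    rw [Pi.add_apply, Finset.sum_apply, Pi.add_apply, Finset.sum_apply, Finset.sum_eq_single i]
    · split_ifs with hi
      · simp [coordField]
      · simpa using h x i (not_le.1 hi)
    · intro j _ hj
      split_ifs
      · simp [coordField, hj.symm]
      · rfl
    · simp
  rw [e]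
  refine N.add_mem (mul_mem_module hf hK) (N.sum_mem fun j _ => ?_)
  split_ifs with hj
  · exact mul_mem_module ((contDiff_pi.1 hV j).sub (hf.mul (contDiff_pi.1 hKs j)))
      (he (coordField_mem hj))
  · exact N.zero_mem

theorem flagField_mem (c : ℝ) (i : ℕ) :
    flagField c i ∈ Submodule.span (smoothFunctions (Fin 11 → ℝ)) (flagGens c i) :=
  Submodule.subset_span (Set.mem_insert _ _)

theorem lastCoordFields_subset (c : ℝ) (i : ℕ) : lastCoordFields (10 - i) ⊆
    (Submodule.span (smoothFunctions (Fin 11 → ℝ)) (flagGens c i) : Set (VF 11)) :=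
  (Set.subset_insert _ _).trans Submodule.subset_span

theorem mem_span_flagGens {c : ℝ} {i : ℕ} {V : VF 11} {f : (Fin 11 → ℝ) → ℝ}
    (hV : ContDiff ℝ ∞ V) (hf : ContDiff ℝ ∞ f)
    (h : ∀ x (j : Fin 11), (j : ℕ) < 10 - i → V x j = f x * flagField c i x j) :
    V ∈ Submodule.span (smoothFunctions (Fin 11 → ℝ)) (flagGens c i) :=
  mem_of_eq_mul (flagField_mem c i) (lastCoordFields_subset c i) (contDiff_flagField c i) hV hf h

theorem coordField_mem_span (c : ℝ) {i : ℕ} {j : Fin 11} (h : 10 ≤ i + j) :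
    coordField j ∈ Submodule.span (smoothFunctions (Fin 11 → ℝ)) (flagGens c i) :=
  lastCoordFields_subset c i (coordField_mem (by omega))

theorem kr₁_eq : kr₁ = coordField 10 := by
  ext x j
  fin_cases j <;> simp [kr₁, coordField]

theorem sections_krDist (c : ℝ) : sections (krDist c) =
    Submodule.span (smoothFunctions (Fin 11 → ℝ)) (flagGens c 0) := by
  apply le_antisymm
  · rintro V ⟨hV, hVD⟩
    refine mem_span_flagGens hV (contDiff_pi.1 hV 4) fun x j hj => ?_
    obtain ⟨a, b, hab⟩ := Submodule.mem_span_pair.1 (hVD x)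
    rw [← hab]
    simp only [kr₁_eq, flagField_of_le c (Nat.zero_le 5)]
    have h10 : (10 : Fin 11) ≠ j := by
      rintro rfl
      simp at hj
    rw [Pi.add_apply, Pi.smul_apply, Pi.smul_apply, Pi.add_apply, Pi.smul_apply, Pi.smul_apply]
    simp [coordField, h10.symm, show kr₂ c x 4 = 1 from rfl]
  · rw [Submodule.span_le]
    rintro V (rfl | ⟨j, hj, rfl⟩)
    · exact ⟨contDiff_flagField c 0, fun x => Submodule.subset_span
        (by simp [flagField_of_le c (Nat.zero_le 5)])⟩
    · have : j = 10 := by omega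
      subst this
      exact ⟨contDiff_coordField _, fun x => Submodule.subset_span (by simp [kr₁_eq])⟩

/-- The relation between consecutive transversal generators. -/
theorem exists_flagField_eq_mul (c : ℝ) {i : ℕ} (hi : i ≤ 8) :
    ∃ f : (Fin 11 → ℝ) → ℝ, ContDiff ℝ ∞ f ∧
      ∀ x (j : Fin 11), (j : ℕ) < 10 - (i + 1) →
        flagField c i x j = f x * flagField c (i + 1) x j := by
  rcases lt_trichotomy i 5 with h | rfl | h
  · exact ⟨fun _ => 1, contDiff_const, fun x j _ => by
      rw [flagField_of_le c h.le, flagField_of_le c h, one_mul]⟩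
  · refine ⟨fun x => x 5, by fun_prop, fun x j hj => ?_⟩
    fin_cases j <;> simp at hj <;> simp [flagField, kr₂]
  · refine ⟨fun _ => 1, contDiff_const, fun x j hj => ?_⟩
    interval_cases i <;> fin_cases j <;> simp at hj <;> simp [flagField]

theorem lieBracket_coordField_flagField_mem (c : ℝ) {i : ℕ} (hi : i ≤ 8) {j : Fin 11}
    (hj : 10 - i ≤ j) : VectorField.lieBracket ℝ (coordField j) (flagField c i) ∈
      Submodule.span (smoothFunctions (Fin 11 → ℝ)) (flagGens c (i + 1)) := by
  rcases lt_or_ge 5 i with h | h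
  · interval_cases i
    · rw [lieBracket_coordField_six c (Fin.le_def.2 hj)]
      split_ifs
      exacts [coordField_mem_span c (by simp), Submodule.zero_mem _]
    · rw [lieBracket_coordField_seven c (Fin.le_def.2 hj)]
      split_ifs
      exacts [coordField_mem_span c (by simp), Submodule.zero_mem _]
    · rw [lieBracket_coordField_eight c (Fin.le_def.2 hj)]
      split_ifs
      exacts [coordField_mem_span c (by simp), Submodule.zero_mem _]
  · rw [flagField_of_le c h, lieBracket_coordField_kr₂ c (Fin.le_def.2 (by simp; omega))]
    rcases h.lt_or_eq with h | rfl
    · fin_cases j <;> simp at hj <;> first | omega | exact coordField_mem_span c (by simp <;> omega)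
    · fin_cases j <;> simp at hj <;>
        first | (exact coordField_mem_span c (by simp)) | exact flagField_mem c 6

theorem lieBracket_next (c : ℝ) {i : ℕ} (hi : i ≤ 8) :
    VectorField.lieBracket ℝ (coordField ⟨10 - i, by omega⟩) (flagField c i) =
      flagBracket c i := by
  rcases lt_or_ge 5 i with h | h
  · interval_cases i
    · exact (lieBracket_coordField_six c (Fin.le_def.2 le_rfl)).trans (if_pos rfl)
    · exact (lieBracket_coordField_seven c (Fin.le_def.2 le_rfl)).trans (if_pos rfl)
    · exact (lieBracket_coordField_eight c (Fin.le_def.2 le_rfl)).trans (if_pos rfl)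
  · rw [flagField_of_le c h, lieBracket_coordField_kr₂ c (Fin.le_def.2 (by simp; omega))]
    congr 1
    simp
    omega

/-- The generation step shared by the derived flag and the Lie flag. Away from i = 5 the new bracket
is the coordinate field ∂(9-i), modulo which the old transversal field becomes the new one. At i = 5
the bracket is K, and the missing ∂4 has to be recovered from κ₂. -/
theorem coordField_mem_of_flagBracket_mem {c : ℝ} {i : ℕ} (hi : i ≤ 8)
    {N : VFModule (Fin 11 → ℝ)} (hN : flagGens c i ⊆ N) (h : flagBracket c i ∈ N) :
    flagGens c (i + 1) ⊆ N := by
  have hK : flagField c i ∈ N := hN (Set.mem_insert _ _)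
  have he : lastCoordFields (10 - i) ⊆ N := (Set.subset_insert _ _).trans hN
  suffices hc : coordField ⟨9 - i, by omega⟩ ∈ N ∧ flagField c (i + 1) ∈ N by
    rintro V (rfl | ⟨j, hj, rfl⟩)
    · exact hc.2
    · rcases Nat.lt_or_ge j (10 - i) with h | h
      · have : j = ⟨9 - i, by omega⟩ := by ext; simp; omega
        rw [this]
        exact hc.1
      · exact he (coordField_mem h)
  have key : ∀ j : Fin 11, (j : ℕ) = 9 - i → coordField j ∈ N → 5 < i →
      flagField c (i + 1) ∈ N := by
    intro j hj hjN h5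
    refine mem_of_eq_mul (m := 9 - i) (f := fun _ => 1) hK ?_ (contDiff_flagField c i)
      (contDiff_flagField c (i + 1)) contDiff_const fun x l hl => ?_
    · rintro _ ⟨l, hl, rfl⟩
      rcases Nat.lt_or_ge l (10 - i) with h | h
      · have : l = j := by ext; omega
        rw [this]
        exact hjN
      · exact he (coordField_mem h)
    · interval_cases i <;> fin_cases l <;> simp at hl <;> simp [flagField]
  rcases lt_trichotomy i 5 with h5 | rfl | h5
  · refine ⟨?_, ?_⟩
    · interval_cases i <;> exact h
    · rw [flagField_of_le c h5, ← flagField_of_le c h5.le]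
      exact hK
  · refine ⟨?_, h⟩
    change coordField 4 ∈ N
    -- κ₂ - x5 K agrees with ∂4 in the coordinates below 5.
    refine mem_of_eq_mul (m := 5) (f := fun _ => 1)
      (N.sub_mem hK (mul_mem_module (f := fun x => x 5) (by fun_prop) h)) he
      ((contDiff_flagField c 5).sub
        (ContDiff.smul (contDiff_apply ℝ ℝ 5) (contDiff_flagField c 6)))
      (contDiff_coordField 4) contDiff_const fun x l hl => ?_
    fin_cases l <;> simp at hl <;> simp [flagField, flagBracket, kr₂, coordField]
  · have h1 : coordField ⟨9 - i, by omega⟩ ∈ N := by interval_cases i <;> exact h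
    exact ⟨h1, key _ rfl h1 h5⟩

theorem flagGens_subset_succ (c : ℝ) {i : ℕ} (hi : i ≤ 8) : flagGens c i ⊆
    (Submodule.span (smoothFunctions (Fin 11 → ℝ)) (flagGens c (i + 1)) : Set (VF 11)) := by
  rintro V (rfl | ⟨j, hj, rfl⟩)
  · obtain ⟨f, hf, h⟩ := exists_flagField_eq_mul c hi
    exact mem_span_flagGens (contDiff_flagField c i) hf h
  · exact coordField_mem_span c (by omega)

theorem derivedFlag_krDist (c : ℝ) {i : ℕ} (hi : i ≤ 9) : derivedFlag (krDist c) i =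
    Submodule.span (smoothFunctions (Fin 11 → ℝ)) (flagGens c i) := by
  induction i with
  | zero => exact sections_krDist c
  | succ i ih =>
    have hi : i ≤ 8 := by omega
    rw [derivedFlag, ih (by omega)]
    refine span_sup_bracket_span contDiff_of_mem_flagGens contDiff_of_mem_flagGens
      (flagGens_subset_succ c hi) (flagGens_subset_succ c hi) ?_ ?_
    · rintro V (rfl | ⟨j, hj, rfl⟩) W (rfl | ⟨k, hk, rfl⟩)
      · rw [VectorField.lieBracket_self]
        exact Submodule.zero_mem _
      · have : VectorField.lieBracket ℝ (flagField c i) (coordField k) =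
            -VectorField.lieBracket ℝ (coordField k) (flagField c i) := by
          ext1 x
          exact VectorField.lieBracket_swap
        rw [this]
        exact Submodule.neg_mem _ (lieBracket_coordField_flagField_mem c hi hk)
      · exact lieBracket_coordField_flagField_mem c hi hj
      · rw [lieBracket_coordField_coordField]
        exact Submodule.zero_mem _
    · refine coordField_mem_of_flagBracket_mem hi
        (fun V hV => Submodule.mem_sup_left (Submodule.subset_span hV))
        (Submodule.mem_sup_right (Submodule.subset_span
          ⟨_, Submodule.subset_span ?_, _, flagField_mem c i, (lieBracket_next c hi).symm⟩))
      exact Set.mem_insert_of_mem _ (coordField_mem (by simp))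

theorem mem_derivedDist_krDist {c : ℝ} {i : ℕ} (hi : i ≤ 9) {p v : Fin 11 → ℝ} :
    v ∈ derivedDist (krDist c) i p ↔
      ∃ a, ∀ j : Fin 11, (j : ℕ) < 10 - i → v j = a * flagField c i p j := by
  rw [derivedDist, derivedFlag_krDist c hi, valuesAt_span]
  constructor
  · intro hv
    induction hv using Submodule.span_induction with
    | mem v hv =>
      obtain ⟨V, (rfl | ⟨j, hj, rfl⟩), rfl⟩ := hv
      · exact ⟨1, fun j _ => (one_mul _).symm⟩
      · refine ⟨0, fun k hk => ?_⟩
        have : k ≠ j := by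
          rintro rfl
          omega
        simp [coordField, this]
    | zero => exact ⟨0, fun j _ => by simp⟩
    | add v w _ _ hv hw =>
      obtain ⟨a, ha⟩ := hv
      obtain ⟨b, hb⟩ := hw
      exact ⟨a + b, fun j hj => by rw [Pi.add_apply, ha j hj, hb j hj, add_mul]⟩
    | smul r v _ hv =>
      obtain ⟨a, ha⟩ := hv
      exact ⟨r * a, fun j hj => by rw [Pi.smul_apply, ha j hj, smul_eq_mul, mul_assoc]⟩
  · rintro ⟨a, ha⟩
    rw [← valuesAt_span]
    -- A global section with value v at p: the constant part has no coordinates below 10 - i, by the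
    -- choice of a.
    have : (fun x => (fun _ => v - a • flagField c i p : VF 11) x + a • flagField c i x) ∈
        Submodule.span (smoothFunctions (Fin 11 → ℝ)) (flagGens c i) := by
      refine mem_span_flagGens (contDiff_const.add ((contDiff_flagField c i).const_smul a)) (contDiff_const (c := a)) fun x j hj => ?_
      simp [ha j hj]
    simpa using apply_mem_valuesAt this p

/-! ### The frame, the ranks and the Goursat property. -/

theorem linearIndependent_kr (c : ℝ) (x : Fin 11 → ℝ) :
    LinearIndependent ℝ ![kr₁ x, kr₂ c x] := by
  rw [LinearIndependent.pair_iff]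
  intro s t h
  have h4 := congrFun h 4
  have h10 := congrFun h 10
  simp [kr₁, kr₂] at h4 h10
  exact ⟨h10, h4⟩

theorem span_range_kr (c : ℝ) (x : Fin 11 → ℝ) :
    Submodule.span ℝ (Set.range ![kr₁ x, kr₂ c x]) = krDist c x := by
  rw [krDist]
  simp [Set.pair_comm]

theorem isFrame_kr (c : ℝ) : IsFrame ![kr₁, kr₂ c] (krDist c) := by
  have h : ∀ x, (fun j => ![kr₁, kr₂ c] j x) = ![kr₁ x, kr₂ c x] := fun x => by
    ext j : 1
    fin_cases j <;> rfl
  refine ⟨fun j => ?_, fun x => ?_⟩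
  · fin_cases j
    exacts [contDiff_const, contDiff_kr₂ c]
  · rw [h]
    exact ⟨linearIndependent_kr c x, span_range_kr c x⟩

theorem isSmoothDistribution_kr (c : ℝ) : IsSmoothDistribution 2 (krDist c) := fun p =>
  ⟨Set.univ, isOpen_univ, Set.mem_univ p, ![kr₁, kr₂ c],
    fun j => ((isFrame_kr c).1 j).contDiffOn, fun x _ => (isFrame_kr c).2 x⟩

theorem derivedDist_krDist_zero (c : ℝ) (p : Fin 11 → ℝ) :
    derivedDist (krDist c) 0 p = krDist c p := by
  apply le_antisymm
  · rw [derivedDist, valuesAt, Submodule.span_le]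
    rintro _ ⟨V, hV, rfl⟩
    exact hV.2 p
  · rw [krDist, Submodule.span_le]
    rintro v (rfl | rfl)
    · exact apply_mem_valuesAt (M := sections (krDist c))
        ⟨contDiff_const, fun x => Submodule.subset_span (Or.inl rfl)⟩ p
    · exact apply_mem_valuesAt (M := sections (krDist c))
        ⟨contDiff_kr₂ c, fun x => Submodule.subset_span (by simp)⟩ p

theorem flagBracket_notMem (c : ℝ) {i : ℕ} (hi : i ≤ 8) (p : Fin 11 → ℝ) :
    flagBracket c i p ∉ derivedDist (krDist c) i p := by
  rw [mem_derivedDist_krDist (by omega)]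
  rintro ⟨a, ha⟩
  -- Coordinate j, where the transversal field is 1 and the bracket is 0, forces a = 0; coordinate k
  -- of the bracket, which is 1, contradicts this.
  have key : ∀ j k : Fin 11, (j : ℕ) < 10 - i → (k : ℕ) < 10 - i → flagField c i p j = 1 →
      flagBracket c i p j = 0 → flagBracket c i p k = 1 → False := by
    intro j k hj hk h1 h2 h3
    have ha0 := ha j hj
    rw [h1, h2, mul_one] at ha0
    have := ha k hk
    rw [h3, ← ha0, zero_mul] at this
    exact one_ne_zero this
  interval_cases i
  · exact key 4 9 (by simp) (by simp) rfl rfl rfl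
  · exact key 4 8 (by simp) (by simp) rfl rfl rfl
  · exact key 4 7 (by simp) (by simp) rfl rfl rfl
  · exact key 4 6 (by simp) (by simp) rfl rfl rfl
  · exact key 4 5 (by simp) (by simp) rfl rfl rfl
  · exact key 4 0 (by simp) (by simp) rfl rfl rfl
  · exact key 0 3 (by simp) (by simp) rfl rfl rfl
  · exact key 0 2 (by simp) (by simp) rfl rfl rfl
  · exact key 0 1 (by simp) (by simp) rfl rfl rfl

theorem derivedFlag_le_succ (D : (Fin 11 → ℝ) → Submodule ℝ (Fin 11 → ℝ)) (i : ℕ) :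
    derivedFlag D i ≤ derivedFlag D (i + 1) := le_sup_left

theorem flagBracket_mem_succ (c : ℝ) {i : ℕ} (hi : i ≤ 8) (p : Fin 11 → ℝ) :
    flagBracket c i p ∈ derivedDist (krDist c) (i + 1) p := by
  rw [derivedDist, derivedFlag_krDist c (by omega), ← lieBracket_next c hi]
  exact apply_mem_valuesAt (lieBracket_coordField_flagField_mem c hi le_rfl) p

theorem finrank_derivedDist_krDist (c : ℝ) {i : ℕ} (hi : i ≤ 9) (p : Fin 11 → ℝ) :
    Module.finrank ℝ (derivedDist (krDist c) i p) = i + 2 := by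
  -- Nine strict increases lead from rank 2 to rank at most 11, so each of them is exactly one.
  set d : ℕ → ℕ := fun i => Module.finrank ℝ (derivedDist (krDist c) i p) with hd
  have hlt : ∀ i ≤ 8, d i < d (i + 1) := fun i hi => by
    refine Submodule.finrank_lt_finrank_of_lt (lt_of_le_of_ne
      (valuesAt_mono (derivedFlag_le_succ _ i) p) fun h => ?_)
    apply flagBracket_notMem c hi p
    rw [show derivedDist (krDist c) i p = derivedDist (krDist c) (i + 1) p from h]
    exact flagBracket_mem_succ c hi p
  have h0 : d 0 = 2 := by
    simp only [hd]
    rw [derivedDist_krDist_zero, ← span_range_kr, finrank_span_eq_card (linearIndependent_kr c p),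
      Fintype.card_fin]
  have h9 : d 9 ≤ 11 := by
    simpa using Submodule.finrank_le (derivedDist (krDist c) 9 p)
  have e : ∀ j, j ≤ 8 → d j < d (j + 1) := hlt
  have := e 0; have := e 1; have := e 2; have := e 3; have := e 4; have := e 5
  have := e 6; have := e 7; have := e 8
  change d i = i + 2
  interval_cases i <;> simp at * <;> omega

theorem isGoursat_krDist (c : ℝ) : IsGoursat (krDist c) := by
  refine ⟨by simp, isSmoothDistribution_kr c, fun i hi p => ?_⟩
  rw [Module.finrank_fin_fun] at hi
  exact finrank_derivedDist_krDist c (by omega) p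

/-! ### The characteristic distributions. -/

theorem lieBracket_coordField_flagField_mem_self (c : ℝ) {i : ℕ} (hi : i ≤ 8) {j : Fin 11}
    (hj : 11 ≤ i + j) : VectorField.lieBracket ℝ (coordField j) (flagField c i) ∈
      Submodule.span (smoothFunctions (Fin 11 → ℝ)) (flagGens c i) := by
  rcases lt_or_ge 5 i with h | h
  · interval_cases i
    · rw [lieBracket_coordField_six c (Fin.le_def.2 (by simp; omega)), if_neg]
      · exact Submodule.zero_mem _
      · rintro rfl
        simp at hj
    · rw [lieBracket_coordField_seven c (Fin.le_def.2 (by simp; omega)), if_neg]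
      · exact Submodule.zero_mem _
      · rintro rfl
        simp at hj
    · rw [lieBracket_coordField_eight c (Fin.le_def.2 (by simp; omega)), if_neg]
      · exact Submodule.zero_mem _
      · rintro rfl
        simp at hj
  · rw [flagField_of_le c h, lieBracket_coordField_kr₂ c (Fin.le_def.2 (by simp; omega))]
    fin_cases j <;> simp at hj <;> first | omega | exact coordField_mem_span c (by simp <;> omega)

theorem flagGens_succ_eq (c : ℝ) {i : ℕ} (hi : i ≤ 9) : flagGens c (i + 1) =
    insert (coordField ⟨9 - i, by omega⟩) (insert (flagField c (i + 1)) (lastCoordFields (10 - i)))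
    := by
  rw [flagGens, Set.insert_comm]
  congr 1
  ext V
  constructor
  · rintro ⟨j, hj, rfl⟩
    rcases Nat.lt_or_ge j (10 - i) with h | h
    · left
      congr 1
      ext
      simp
      omega
    · exact Or.inr ⟨j, h, rfl⟩
  · rintro (rfl | ⟨j, hj, rfl⟩)
    · exact coordField_mem (by simp)
    · exact coordField_mem (by omega)

/-- The two remaining generators of D⁽ⁱ⁺¹⁾ are ∂(9-i) and `flagField c (i + 1)`. Their bracket is
the next field of the flag, which is nowhere tangent to D⁽ⁱ⁺¹⁾, so `characteristic_span_insert`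
applies. -/
theorem characteristic_krDist (c : ℝ) {i : ℕ} (hi : i ≤ 7) :
    characteristic (derivedFlag (krDist c) (i + 1)) =
      Submodule.span (smoothFunctions (Fin 11 → ℝ)) (lastCoordFields (10 - i)) := by
  have e := flagGens_succ_eq c (show i ≤ 9 by omega)
  rw [derivedFlag_krDist c (by omega), e]
  refine characteristic_span_insert contDiff_of_mem_lastCoordFields (contDiff_coordField _)
    (contDiff_flagField c _) ?_ ?_
  · rw [← e]
    rintro _ ⟨j, hj, rfl⟩ W (rfl | ⟨k, hk, rfl⟩)
    · exact lieBracket_coordField_flagField_mem_self c (by omega) (by omega)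
    · rw [lieBracket_coordField_coordField]
      exact Submodule.zero_mem _
  · intro p
    rw [← e, ← valuesAt_span, ← derivedFlag_krDist c (by omega)]
    have := lieBracket_next c (show i + 1 ≤ 8 by omega)
    simp only [Nat.reduceSubDiff] at this
    rw [this]
    exact flagBracket_notMem c (by omega) p

theorem mem_charDist_krDist {c : ℝ} {i : ℕ} (hi : i ≤ 7) {p v : Fin 11 → ℝ} :
    v ∈ charDist (krDist c) i p ↔ ∀ j : Fin 11, (j : ℕ) < 10 - i → v j = 0 := by
  rw [charDist, characteristic_krDist c hi, valuesAt_span]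
  constructor
  · intro hv j hj
    induction hv using Submodule.span_induction with
    | mem v hv =>
      obtain ⟨_, ⟨k, hk, rfl⟩, rfl⟩ := hv
      have : j ≠ k := by
        rintro rfl
        omega
      simp [coordField, this]
    | zero => rfl
    | add v w _ _ hv hw => rw [Pi.add_apply, hv, hw, add_zero]
    | smul r v _ hv => rw [Pi.smul_apply, hv, smul_zero]
  · intro h
    rw [pi_eq_sum_univ' v]
    refine Submodule.sum_mem _ fun j _ => ?_
    rcases Nat.lt_or_ge j (10 - i) with hj | hj
    · rw [h j hj, zero_smul]
      exact Submodule.zero_mem _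
    · refine Submodule.smul_mem _ _ (Submodule.subset_span ⟨_, coordField_mem hj, ?_⟩)
      ext k
      simp [coordField, Pi.single_apply, eq_comm]

/-! ### The singularity type -/

theorem tangentVectors_coord_eq_zero (J : Set (Fin 11)) {p : Fin 11 → ℝ} (hp : ∀ j ∈ J, p j = 0) :
    tangentVectors {x : Fin 11 → ℝ | ∀ j ∈ J, x j = 0} p = {v | ∀ j ∈ J, v j = 0} := by
  ext v
  constructor
  · rintro ⟨γ, hγ, -, hS, rfl⟩ j hj
    have hd : DifferentiableAt ℝ γ 0 := hγ.contDiffAt.differentiableAt (by simp)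
    have h1 := (hasDerivAt_pi.1 hd.hasDerivAt) j
    have h2 : (fun t => γ t j) =ᶠ[𝓝 0] fun _ => 0 := hS.mono fun t ht => ht j hj
    exact h1.unique ((hasDerivAt_const (0 : ℝ) (0 : ℝ)).congr_of_eventuallyEq h2)
  · intro hv
    refine ⟨fun t => p + t • v, by fun_prop, by simp, Filter.Eventually.of_forall fun t j hj => ?_, ?_⟩
    · simp [hp j hj, hv j hj]
    · have : HasDerivAt (fun t : ℝ => p + t • v) ((1 : ℝ) • v) 0 :=
        ((hasDerivAt_id (0 : ℝ)).smul_const v).const_add p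
      rw [this.deriv, one_smul]

/-- Equality of D⁽ⁱ⁾(p) with C_{i+1}(p) requires the transversal field to have no coordinates below
9 - i. For i < 5 coordinate 4 equals 1 and for i = 6 coordinate 0 equals 1; for i = 5 the
coordinates in question all carry the factor x5. -/
theorem mem_singularSet_zero {c : ℝ} {i : ℕ} {p : Fin 11 → ℝ} :
    p ∈ singularSet (krDist c) i 0 ↔ i = 5 ∧ p 5 = 0 := by
  change (i + 5 ≤ Module.finrank ℝ (Fin 11 → ℝ) ∧ _) ↔ _
  rw [Module.finrank_fin_fun]
  constructor
  · rintro ⟨hi, h⟩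
    have hK : flagField c i p ∈ charDist (krDist c) (i + 1) p := by
      rw [← h, mem_derivedDist_krDist (by omega)]
      exact ⟨1, fun j _ => (one_mul _).symm⟩
    rw [mem_charDist_krDist (by omega)] at hK
    rcases lt_trichotomy i 5 with h5 | rfl | h5
    · have := hK 4 (by simp; omega)
      rw [flagField_of_le c h5.le] at this
      exact absurd this one_ne_zero
    · exact ⟨rfl, hK 0 (by simp)⟩
    · obtain rfl : i = 6 := by omega
      exact absurd (hK 0 (by simp)) one_ne_zero
  · rintro ⟨rfl, hp⟩
    refine ⟨by norm_num, ?_⟩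
    ext v
    rw [mem_derivedDist_krDist (by norm_num), mem_charDist_krDist (by norm_num)]
    constructor
    · rintro ⟨a, ha⟩ j hj
      rw [ha j (by omega)]
      fin_cases j <;> simp at hj <;> simp [flagField, kr₂, hp]
    · intro h
      refine ⟨v 4, fun j hj => ?_⟩
      fin_cases j <;> simp at hj <;> simp [flagField, kr₂, hp, h]

theorem singularSet_eq_empty {c : ℝ} {i : ℕ} (hi : i ≠ 5) (j : ℕ) :
    singularSet (krDist c) i j = ∅ := by
  rw [Set.eq_empty_iff_forall_notMem]
  induction j with
  | zero => exact fun p hp => hi (mem_singularSet_zero.1 hp).1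
  | succ j ih => exact fun p hp => ih p hp.2.1

/-- One step of the tower of canonical submanifolds over the singular hyperplane. -/
theorem singularSet_succ {c : ℝ} {j : ℕ} (hj : j ≤ 3) {J : Set (Fin 11)}
    (hJ : singularSet (krDist c) 5 j = {x | ∀ l ∈ J, x l = 0})
    (hJmem : ∀ l : Fin 11, l ∈ J ↔ 5 ≤ (l : ℕ) ∧ (l : ℕ) ≤ 5 + j) :
    singularSet (krDist c) 5 (j + 1) =
      {x | (∀ l ∈ J, x l = 0) ∧ ∀ l ∈ J, kr₂ c x l = 0} := by
  ext p
  change (j + 1 ≤ 5 ∧ p ∈ singularSet (krDist c) 5 j ∧ _) ↔ _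
  rw [hJ]
  refine ⟨fun ⟨_, hp, h⟩ => ⟨hp, ?_⟩, fun ⟨hp, h⟩ => ⟨by omega, hp, fun h' => ?_⟩⟩
  · rw [tangentVectors_coord_eq_zero J hp] at h
    -- If κ₂ leaves the submanifold, tangency kills its coefficient, and the intersection reduces to
    -- the characteristic directions, which are tangent because J is exactly the range 5, ..., 5 +
    -- j.
    by_contra hne
    push Not at hne
    obtain ⟨l, hl, hne⟩ := hne
    apply h
    ext v
    simp only [Set.mem_inter_iff, SetLike.mem_coe, Set.mem_ofPred_eq]
    rw [mem_derivedDist_krDist (by omega), mem_charDist_krDist (by omega),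
      flagField_of_le c (by omega)]
    constructor
    · rintro ⟨⟨a, ha⟩, hv⟩ m hm
      have := ha l (by have := (hJmem l).1 hl; omega)
      rw [hv l hl] at this
      rw [ha m hm, (mul_eq_zero.1 this.symm).resolve_right hne, zero_mul]
    · intro hv
      refine ⟨⟨0, fun m hm => by rw [hv m hm, zero_mul]⟩, fun m hm => hv m ?_⟩
      have := (hJmem m).1 hm
      omega
  · rw [tangentVectors_coord_eq_zero J hp] at h'
    have hmem : kr₂ c p ∈ (charDist (krDist c) (5 - (j + 1)) p : Set (Fin 11 → ℝ)) := by
      rw [← h']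
      refine ⟨?_, h⟩
      rw [SetLike.mem_coe, mem_derivedDist_krDist (by omega), flagField_of_le c (by omega)]
      exact ⟨1, fun m _ => (one_mul _).symm⟩
    rw [SetLike.mem_coe, mem_charDist_krDist (by omega)] at hmem
    exact one_ne_zero (hmem 4 (by simp; omega))

theorem singularSet_five_zero (c : ℝ) :
    singularSet (krDist c) 5 0 = {x | ∀ l ∈ ({5} : Set (Fin 11)), x l = 0} := by
  ext p
  simp [mem_singularSet_zero]

theorem singularSet_five_one (c : ℝ) :
    singularSet (krDist c) 5 1 = {x | ∀ l ∈ ({5, 6} : Set (Fin 11)), x l = 0} := by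
  rw [singularSet_succ (by norm_num) (singularSet_five_zero c)]
  · ext p
    simp [kr₂]
  · intro l
    fin_cases l <;> simp

theorem singularSet_five_two (c : ℝ) :
    singularSet (krDist c) 5 2 = {x | ∀ l ∈ ({5, 6, 7} : Set (Fin 11)), x l = 0} := by
  rw [singularSet_succ (by norm_num) (singularSet_five_one c)]
  · ext p
    simp [kr₂]
    tauto
  · intro l
    fin_cases l <;> simp

theorem zero_notMem_singularSet_five (c : ℝ) {j : ℕ} (hj : 3 ≤ j) :
    (0 : Fin 11 → ℝ) ∉ singularSet (krDist c) 5 j := by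
  induction j, hj using Nat.le_induction with
  | base =>
    rw [singularSet_succ (by norm_num) (singularSet_five_two c)]
    · simp [kr₂]
    · intro l
      fin_cases l <;> simp
  | succ j _ ih => exact fun h => ih h.2.1

theorem zero_mem_singularSet_iff {c : ℝ} {i j : ℕ} :
    (0 : Fin 11 → ℝ) ∈ singularSet (krDist c) i j ↔ i = 5 ∧ j ≤ 2 := by
  constructor
  · intro h
    have hi : i = 5 := by
      by_contra hi
      rw [singularSet_eq_empty hi] at h
      exact h
    subst hi
    refine ⟨rfl, ?_⟩
    by_contra hj
    exact zero_notMem_singularSet_five c (by omega) h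
  · rintro ⟨rfl, hj⟩
    interval_cases j
    · simp [singularSet_five_zero]
    · simp [singularSet_five_one]
    · simp [singularSet_five_two]

theorem singularityLetter_zero (c : ℝ) (i : ℕ) :
    singularityLetter (krDist c) 0 i = if 3 ≤ i ∧ i ≤ 5 then 6 - i else 0 := by
  classical
  unfold singularityLetter
  split_ifs with h hi hi
  · have hj : i + (5 - i) = 5 ∧ 5 - i ≤ 2 := by omega
    have h1 := Nat.find_spec h
    rw [zero_mem_singularSet_iff] at h1
    omega
  · have h1 := Nat.find_spec h
    rw [zero_mem_singularSet_iff] at h1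
    omega
  · exact absurd ⟨5 - i, zero_mem_singularSet_iff.2 (by omega)⟩ h
  · rfl

theorem singularityType_krDist (c : ℝ) :
    singularityType (krDist c) 0 = [0, 0, 1, 2, 3, 0, 0, 0] := by
  rw [singularityType, Module.finrank_fin_fun,
    show singularityLetter (krDist c) 0 = _ from funext (singularityLetter_zero c)]
  decide

/-! ### The family consists of Kumpera-Ruiz normal forms -/

theorem isKumperaRuiz_kr (c : ℝ) : IsKumperaRuiz 11 kr₁ (kr₂ c) := by
  -- The k-th prolongation creates coordinate k + 2; the singular one creates x5, and each regular
  -- constant is the shift of the new coordinate in κ₂.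
  have h := IsKumperaRuiz.base.regular 0 |>.regular 0 |>.singular |>.regular 0 |>.regular 0
    |>.regular 1 |>.regular 1 |>.regular c
  convert h using 1
  · ext x j
    fin_cases j <;> rfl
  · ext x j
    simp only [Pi.add_apply, Pi.smul_apply, smul_eq_mul, lift, Fin.snoc, Fin.init, lastField]
    fin_cases j <;>
      simp [kr₂, Pi.single_apply, Fin.ext_iff, Fin.castLT]

/-! ### The growth vector -/

theorem lieBracket_kr₂_coordField (c : ℝ) (j : Fin 11) :
    VectorField.lieBracket ℝ (kr₂ c) (coordField j) =
      -VectorField.lieBracket ℝ (coordField j) (kr₂ c) := by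
  ext1 x
  exact VectorField.lieBracket_swap

theorem lieBracket_coordField_four (c : ℝ) :
    VectorField.lieBracket ℝ (coordField 4) (kr₂ c) = fun x => x 5 • coordField 3 x := by
  rw [lieBracket_coordField_left]
  ext x m
  rw [fderiv_kr₂]
  fin_cases m <;> simp [coordField]

theorem lieBracket_kr₂_six (c : ℝ) :
    VectorField.lieBracket ℝ (kr₂ c) (flagField c 6) = coordField 3 := by
  ext x m
  rw [VectorField.lieBracket, fderiv_kr₂, fderiv_flagField_six]
  fin_cases m <;> simp [coordField, flagField, kr₂]

/-- The sections of the distribution are generated by κ₂ and ∂10, so upper bounds for the Lie flag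
need only brackets with these two fields. -/
theorem lieFlag_succ_le {c : ℝ} {i : ℕ} {S : Set (VF 11)} {N : VFModule (Fin 11 → ℝ)}
    (hS : ∀ V ∈ S, ContDiff ℝ ∞ V)
    (hi : lieFlag (krDist c) i ≤ Submodule.span (smoothFunctions (Fin 11 → ℝ)) S)
    (hSN : S ⊆ N) (h0 : kr₂ c ∈ N) (h0' : coordField 10 ∈ N)
    (h1 : ∀ V ∈ S, VectorField.lieBracket ℝ (kr₂ c) V ∈ N)
    (h2 : ∀ V ∈ S, VectorField.lieBracket ℝ (coordField 10) V ∈ N) :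
    lieFlag (krDist c) (i + 1) ≤ N := by
  have e : flagGens c 0 = {kr₂ c, coordField 10} := by
    rw [flagGens, flagField_of_le c (by norm_num)]
    congr 1
    ext V
    constructor
    · rintro ⟨j, hj, rfl⟩
      congr 1
      omega
    · rintro rfl
      exact coordField_mem (by simp)
  have hk : ∀ V ∈ flagGens c 0, V ∈ N := by
    rw [e]
    rintro V (rfl | rfl)
    exacts [h0, h0']
  refine sup_le (hi.trans (Submodule.span_le.2 hSN)) (Submodule.span_le.2 ?_)
  rintro _ ⟨V, hV, W, hW, rfl⟩
  rw [sections_krDist] at hV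
  refine lieBracket_mem_of_mem_span hS contDiff_of_mem_flagGens hSN hk ?_ hV (hi hW)
  rw [e]
  rintro V (rfl | rfl) W hW
  exacts [h1 W hW, h2 W hW]

theorem lieFlag_le_succ (D : (Fin 11 → ℝ) → Submodule ℝ (Fin 11 → ℝ)) (i : ℕ) :
    lieFlag D i ≤ lieFlag D (i + 1) := le_sup_left

theorem lieFlag_mono (D : (Fin 11 → ℝ) → Submodule ℝ (Fin 11 → ℝ)) : Monotone (lieFlag D) :=
  monotone_nat_of_le_succ (lieFlag_le_succ D)

theorem kr₂_mem_lieFlag (c : ℝ) (i : ℕ) : kr₂ c ∈ lieFlag (krDist c) i := by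
  refine lieFlag_mono _ (Nat.zero_le i) ?_
  rw [lieFlag, sections_krDist, ← flagField_of_le c (Nat.zero_le 5)]
  exact flagField_mem c 0

theorem lieBracket_mem_lieFlag_succ {c : ℝ} {i : ℕ} {V : VF 11}
    (hV : V ∈ lieFlag (krDist c) i) :
    VectorField.lieBracket ℝ (kr₂ c) V ∈ lieFlag (krDist c) (i + 1) :=
  Submodule.mem_sup_right (Submodule.subset_span ⟨_, kr₂_mem_lieFlag c 0, V, hV, rfl⟩)

theorem kr₂_mem_span (c : ℝ) {i : ℕ} (hi : i ≤ 9) :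
    kr₂ c ∈ Submodule.span (smoothFunctions (Fin 11 → ℝ)) (flagGens c i) := by
  induction i with
  | zero =>
    rw [← flagField_of_le c (Nat.zero_le 5)]
    exact flagField_mem c 0
  | succ i ih =>
    exact Submodule.span_le.2 (flagGens_subset_succ c (by omega)) (ih (by omega))

/-- Up to i = 5 the transversal generator is κ₂ itself, so bracketing with the sections loses
nothing. At i = 6 it is K, and ∂3 still arises as [κ₂, K]. The agreement is claimed only up to 7:
bracketing ∂3 with κ₂ gives merely a multiple x5∂2, which vanishes at the origin. -/
theorem lieFlag_krDist (c : ℝ) {i : ℕ} (hi : i ≤ 7) : lieFlag (krDist c) i =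
    Submodule.span (smoothFunctions (Fin 11 → ℝ)) (flagGens c i) := by
  induction i with
  | zero => exact sections_krDist c
  | succ i ih =>
    have ih := ih (by omega)
    have key : ∀ j : Fin 11, 10 - i ≤ j → VectorField.lieBracket ℝ (coordField j) (kr₂ c) ∈
        Submodule.span (smoothFunctions (Fin 11 → ℝ)) (flagGens c (i + 1)) := by
      intro j hj
      rcases Nat.lt_or_ge 5 i with h | h
      · obtain rfl : i = 6 := by omega
        rcases Nat.lt_or_ge j 5 with h5 | h5
        · obtain rfl : j = 4 := by omega
          rw [lieBracket_coordField_four]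
          exact mul_mem_module (by fun_prop) (coordField_mem_span c (by simp))
        · have := lieBracket_coordField_flagField_mem c (i := 5) (by norm_num) h5
          exact Submodule.span_le.2 (flagGens_subset_succ c (by norm_num)) this
      · rw [← flagField_of_le c h]
        exact lieBracket_coordField_flagField_mem c (by omega) hj
    apply le_antisymm
    · refine lieFlag_succ_le contDiff_of_mem_flagGens ih.le (flagGens_subset_succ c (by omega))
        (kr₂_mem_span c (by omega)) (coordField_mem_span c (by simp)) ?_ ?_
      · rintro V (rfl | ⟨j, hj, rfl⟩)
        · rcases Nat.lt_or_ge 5 i with h | h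
          · obtain rfl : i = 6 := by omega
            rw [lieBracket_kr₂_six]
            exact coordField_mem_span c (by simp)
          · rw [flagField_of_le c h, VectorField.lieBracket_self]
            exact Submodule.zero_mem _
        · rw [lieBracket_kr₂_coordField]
          exact Submodule.neg_mem _ (key j hj)
      · rintro V (rfl | ⟨j, hj, rfl⟩)
        · exact lieBracket_coordField_flagField_mem c (by omega) (by simp)
        · rw [lieBracket_coordField_coordField]
          exact Submodule.zero_mem _
    · rw [Submodule.span_le]
      have hsub : flagGens c i ⊆ lieFlag (krDist c) (i + 1) := fun V hV =>
        lieFlag_le_succ _ _ (by rw [ih]; exact Submodule.subset_span hV)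
      refine coordField_mem_of_flagBracket_mem (by omega) hsub ?_
      rcases Nat.lt_or_ge 5 i with h | h
      · obtain rfl : i = 6 := by omega
        change coordField 3 ∈ _
        rw [← lieBracket_kr₂_six c]
        refine lieBracket_mem_lieFlag_succ ?_
        rw [ih]
        exact flagField_mem c 6
      · rw [← lieBracket_next c (by omega), flagField_of_le c h, ← Submodule.neg_mem_iff,
          ← lieBracket_kr₂_coordField]
        refine lieBracket_mem_lieFlag_succ ?_
        rw [ih]
        exact coordField_mem_span c (by simp; omega)

/-- Up to sign, the iterated brackets of `κ₂` with `∂/∂x₄`. -/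
def growthField (c : ℝ) : ℕ → VF 11
  | 1 => fun x => ![0, 0, x 5, 0, 0, 0, 0, 0, 0, 0, 0]
  | 2 => fun x => ![0, -(x 5 * x 5), x 6, 0, 0, 0, 0, 0, 0, 0, 0]
  | 3 => fun x => ![0, -(3 * (x 5 * x 6)), x 7, 0, 0, 0, 0, 0, 0, 0, 0]
  | 4 => fun x => ![0, -(4 * (x 5 * x 7) + 3 * (x 6 * x 6)), x 8 + 1, 0, 0, 0, 0, 0, 0, 0, 0]
  | 5 => fun x => ![0, -(5 * (x 5 * (x 8 + 1)) + 10 * (x 6 * x 7)), x 9 + 1,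
      0, 0, 0, 0, 0, 0, 0, 0]
  | 6 => fun x => ![0, -(6 * (x 5 * (x 9 + 1)) + 15 * (x 6 * (x 8 + 1)) + 10 * (x 7 * x 7)),
      x 10 + c, 0, 0, 0, 0, 0, 0, 0, 0]
  | 7 => fun x => ![0, -(7 * (x 5 * (x 10 + c)) + 21 * (x 6 * (x 9 + 1)) + 35 * (x 7 * (x 8 + 1))),
      0, 0, 0, 0, 0, 0, 0, 0, 0]
  | 8 => fun x => ![0, -(28 * (x 6 * (x 10 + c)) + 56 * (x 7 * (x 9 + 1))
      + 35 * ((x 8 + 1) * (x 8 + 1))), 0, 0, 0, 0, 0, 0, 0, 0, 0]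
  | _ => fun _ => 0

theorem contDiff_growthField (c : ℝ) (n : ℕ) : ContDiff ℝ ∞ (growthField c n) := by
  unfold growthField
  split
  on_goal 9 => exact contDiff_const
  all_goals
    rw [contDiff_pi]
    intro m
    fin_cases m <;> simp <;> fun_prop

theorem lieBracket_coordField_three (c : ℝ) :
    VectorField.lieBracket ℝ (coordField 3) (kr₂ c) = growthField c 1 := by
  rw [lieBracket_coordField_left]
  ext x m
  rw [fderiv_kr₂]
  fin_cases m <;> simp [growthField]

set_option maxHeartbeats 1000000 in
theorem lieBracket_kr₂_growthField (c : ℝ) {n : ℕ} (h1 : 1 ≤ n) (h7 : n ≤ 7) :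
    VectorField.lieBracket ℝ (kr₂ c) (growthField c n) = growthField c (n + 1) := by
  ext x m
  rw [VectorField.lieBracket, fderiv_kr₂, Pi.sub_apply,
    fderiv_pi_apply ((contDiff_growthField c n).contDiffAt.differentiableAt (by simp))]
  interval_cases n <;> fin_cases m <;>
    simp (disch := fun_prop) [-neg_add_rev, growthField, kr₂, fderiv_fun_mul, fderiv_fun_add,
      fderiv_fun_neg, fderiv_coord] <;>
    ring_nf

theorem lieBracket_coordField_growthField (c : ℝ) {n : ℕ} (h1 : 1 ≤ n) (h7 : n ≤ 6) :
    VectorField.lieBracket ℝ (coordField 10) (growthField c n) =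
      if n = 6 then coordField 2 else 0 := by
  rw [lieBracket_coordField_left]
  ext x m
  rw [fderiv_pi_apply ((contDiff_growthField c n).contDiffAt.differentiableAt (by simp))]
  interval_cases n <;> fin_cases m <;>
    simp (disch := fun_prop) [-neg_add_rev, growthField, fderiv_fun_mul, fderiv_fun_add,
      fderiv_fun_neg, fderiv_coord, coordField, Pi.single_apply]

theorem lieBracket_kr₂_seven (c : ℝ) :
    VectorField.lieBracket ℝ (kr₂ c) (flagField c 7) = fun x => x 4 • growthField c 1 x := by
  ext x m
  rw [VectorField.lieBracket, fderiv_kr₂, fderiv_flagField_seven]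
  fin_cases m <;> simp [flagField, kr₂, growthField, mul_comm]

theorem growthField_mem_lieFlag (c : ℝ) {n : ℕ} (hn : n ≤ 7) :
    growthField c (n + 1) ∈ lieFlag (krDist c) (8 + n) := by
  induction n with
  | zero =>
    rw [← lieBracket_coordField_three, ← Submodule.neg_mem_iff, ← lieBracket_kr₂_coordField]
    refine lieBracket_mem_lieFlag_succ ?_
    rw [lieFlag_krDist c le_rfl]
    exact coordField_mem_span c (by simp)
  | succ n ih =>
    rw [← lieBracket_kr₂_growthField c (by omega) (by omega)]
    exact lieBracket_mem_lieFlag_succ (ih (by omega))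

/-- Generators of the Lie flag beyond the seventh term. -/
def growthGens (c : ℝ) (n : ℕ) : Set (VF 11) :=
  flagGens c 7 ∪ {V | ∃ m, 1 ≤ m ∧ m ≤ n ∧ V = growthField c m}

theorem contDiff_of_mem_growthGens {c : ℝ} {n : ℕ} : ∀ V ∈ growthGens c n, ContDiff ℝ ∞ V := by
  rintro V (hV | ⟨m, -, -, rfl⟩)
  exacts [contDiff_of_mem_flagGens V hV, contDiff_growthField c m]

theorem growthGens_mono (c : ℝ) {m n : ℕ} (h : m ≤ n) : growthGens c m ⊆ growthGens c n := by
  rintro V (hV | ⟨k, h1, h2, rfl⟩)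
  exacts [Or.inl hV, Or.inr ⟨k, h1, h2.trans h, rfl⟩]

/-- The target `N` is left free because of n = 6: there x10 occurs in the sixth growth field, and
the bracket with ∂10 produces the additional generator ∂2. -/
theorem lieFlag_succ_le_growthGens {c : ℝ} {n : ℕ} (hn : n ≤ 6)
    {N : VFModule (Fin 11 → ℝ)}
    (h : lieFlag (krDist c) (7 + n) ≤
      Submodule.span (smoothFunctions (Fin 11 → ℝ)) (growthGens c n))
    (hN : growthGens c (n + 1) ⊆ N) (h6 : n = 6 → coordField 2 ∈ N) :
    lieFlag (krDist c) (7 + n + 1) ≤ N := by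
  have hflag : Submodule.span (smoothFunctions (Fin 11 → ℝ)) (flagGens c 7) ≤ N :=
    Submodule.span_le.2 (Set.subset_union_left.trans hN)
  have hg : ∀ m, 1 ≤ m → m ≤ n + 1 → growthField c m ∈ N := fun m h1 h2 =>
    hN (Or.inr ⟨m, h1, h2, rfl⟩)
  refine lieFlag_succ_le contDiff_of_mem_growthGens h ((growthGens_mono c n.le_succ).trans hN)
    (hflag (kr₂_mem_span c (by norm_num))) (hflag (coordField_mem_span c (by simp))) ?_ ?_
  · rintro V ((rfl | ⟨j, hj, rfl⟩) | ⟨m, hm1, hm2, rfl⟩)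
    · rw [lieBracket_kr₂_seven]
      exact mul_mem_module (by fun_prop) (hg 1 le_rfl (by omega))
    · rw [lieBracket_kr₂_coordField, Submodule.neg_mem_iff]
      rcases Nat.lt_or_ge j 5 with h5 | h5
      · rcases Nat.lt_or_ge j 4 with h4 | h4
        · obtain rfl : j = 3 := by omega
          rw [lieBracket_coordField_three]
          exact hg 1 le_rfl (by omega)
        · obtain rfl : j = 4 := by omega
          rw [lieBracket_coordField_four]
          exact hflag (mul_mem_module (by fun_prop) (coordField_mem_span c (by simp)))
      · have := lieBracket_coordField_flagField_mem c (i := 5) (by norm_num) h5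
        exact hflag (Submodule.span_le.2 (flagGens_subset_succ c (by norm_num)) this)
    · rw [lieBracket_kr₂_growthField c hm1 (by omega)]
      exact hg _ (by omega) (by omega)
  · rintro V ((rfl | ⟨j, hj, rfl⟩) | ⟨m, hm1, hm2, rfl⟩)
    · exact hflag (lieBracket_coordField_flagField_mem_self c (by norm_num) (by simp))
    · rw [lieBracket_coordField_coordField]
      exact N.zero_mem
    · rw [lieBracket_coordField_growthField c hm1 (by omega)]
      split_ifs with hm
      exacts [h6 (by omega), N.zero_mem]

theorem lieFlag_le_growthGens (c : ℝ) {n : ℕ} (hn : n ≤ 6) : lieFlag (krDist c) (7 + n) ≤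
    Submodule.span (smoothFunctions (Fin 11 → ℝ)) (growthGens c n) := by
  induction n with
  | zero =>
    rw [lieFlag_krDist c le_rfl]
    exact Submodule.span_mono Set.subset_union_left
  | succ n ih =>
    exact lieFlag_succ_le_growthGens (by omega) (ih (by omega)) Submodule.subset_span
      fun h => by omega

theorem valuesAt_le_of_forall {S : Set (VF 11)} {M : VFModule (Fin 11 → ℝ)}
    (hM : M ≤ Submodule.span (smoothFunctions (Fin 11 → ℝ)) S) {p : Fin 11 → ℝ}
    {W : Submodule ℝ (Fin 11 → ℝ)} (h : ∀ V ∈ S, V p ∈ W) : valuesAt M p ≤ W := by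
  refine (valuesAt_mono hM p).trans ?_
  rw [valuesAt_span, Submodule.span_le]
  rintro _ ⟨V, hV, rfl⟩
  exact h V hV

theorem flagGens_apply_mem (c : ℝ) {i : ℕ} (hi : i ≤ 9) {V : VF 11} (hV : V ∈ flagGens c i)
    (p : Fin 11 → ℝ) : V p ∈ derivedDist (krDist c) i p := by
  rw [derivedDist, derivedFlag_krDist c hi]
  exact apply_mem_valuesAt (Submodule.subset_span hV) p

theorem derivedDist_mono_succ (c : ℝ) (i : ℕ) (p : Fin 11 → ℝ) :
    derivedDist (krDist c) i p ≤ derivedDist (krDist c) (i + 1) p :=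
  valuesAt_mono (derivedFlag_le_succ _ i) p

theorem growthField_apply_zero_mem_seven (c : ℝ) {m : ℕ} (h1 : 1 ≤ m) (h3 : m ≤ 3) :
    growthField c m 0 ∈ derivedDist (krDist c) 7 0 := by
  have : growthField c m 0 = 0 := by
    ext j
    interval_cases m <;> fin_cases j <;> simp [growthField]
  rw [this]
  exact Submodule.zero_mem _

theorem growthField_apply_zero_mem_eight (c : ℝ) {m : ℕ} (h1 : 1 ≤ m) (h7 : m ≤ 7) :
    growthField c m 0 ∈ derivedDist (krDist c) 8 0 := by
  rw [mem_derivedDist_krDist (by norm_num)]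
  refine ⟨0, fun j hj => ?_⟩
  interval_cases m <;> fin_cases j <;> simp at hj <;> simp [growthField]

/-- Monotonicity reduces everything to bounds at the indices 7, 10, 11, 14 and 15. At the origin the
first three growth fields vanish, the fourth is ∂2, the next three are multiples of ∂2, and the
eighth has ∂1 component -35. The parameter enters at 0 only through the ∂2 component of the sixth.
-/
theorem growthVector_krDist (c : ℝ) (i : ℕ) : growthVector (krDist c) 0 i =
    if i ≤ 7 then i + 2 else if i ≤ 10 then 9 else if i ≤ 14 then 10 else 11 := by
  have hmono : ∀ {i j : ℕ}, i ≤ j → valuesAt (lieFlag (krDist c) i) 0 ≤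
      valuesAt (lieFlag (krDist c) j) 0 := fun h => valuesAt_mono (lieFlag_mono _ h) 0
  have hsmall : ∀ i ≤ 7, valuesAt (lieFlag (krDist c) i) 0 = derivedDist (krDist c) i 0 := by
    intro i hi
    rw [lieFlag_krDist c hi, derivedDist, derivedFlag_krDist c (by omega)]
  have hmid : ∀ n ≤ 3, valuesAt (lieFlag (krDist c) (7 + n)) 0 ≤
      derivedDist (krDist c) 7 0 := fun n hn =>
    valuesAt_le_of_forall (lieFlag_le_growthGens c (by omega)) <| by
      rintro V (hV | ⟨m, h1, h2, rfl⟩)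
      · exact flagGens_apply_mem c (by norm_num) hV 0
      · exact growthField_apply_zero_mem_seven c h1 (by omega)
  -- Index 14 is the step at which ∂2 becomes a generator; at the origin no generator up to here has
  -- a ∂1 component.
  have hlarge : valuesAt (lieFlag (krDist c) 14) 0 ≤ derivedDist (krDist c) 8 0 := by
    refine valuesAt_le_of_forall (S := insert (coordField 2) (growthGens c 7))
      (lieFlag_succ_le_growthGens le_rfl (lieFlag_le_growthGens c le_rfl) ?_ fun _ => ?_) ?_
    · exact (Set.subset_insert _ _).trans Submodule.subset_span
    · exact Submodule.subset_span (Set.mem_insert _ _)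
    · rintro V (rfl | hV | ⟨m, h1, h2, rfl⟩)
      · exact flagGens_apply_mem c (i := 8) (by norm_num) (Or.inr (coordField_mem (by simp))) 0
      · exact derivedDist_mono_succ c 7 0 (flagGens_apply_mem c (by norm_num) hV 0)
      · exact growthField_apply_zero_mem_eight c h1 h2
  have h11 : valuesAt (lieFlag (krDist c) 7) 0 < valuesAt (lieFlag (krDist c) 11) 0 := by
    refine lt_of_le_of_ne (hmono (by norm_num)) fun h => ?_
    have hm := apply_mem_valuesAt (growthField_mem_lieFlag c (n := 3) (by norm_num)) 0
    rw [← h, hsmall 7 le_rfl, mem_derivedDist_krDist (by norm_num)] at hm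
    obtain ⟨a, ha⟩ := hm
    have h0 := ha 0 (by simp)
    have h2 := ha 2 (by simp)
    simp [growthField, flagField] at h0 h2
  have h15 : valuesAt (lieFlag (krDist c) 14) 0 < valuesAt (lieFlag (krDist c) 15) 0 := by
    refine lt_of_le_of_ne (hmono (by norm_num)) fun h => ?_
    have hm := apply_mem_valuesAt (growthField_mem_lieFlag c (n := 7) (by norm_num)) 0
    rw [← h] at hm
    have hm := hlarge hm
    rw [mem_derivedDist_krDist (by norm_num)] at hm
    obtain ⟨a, ha⟩ := hm
    have h1 := ha 1 (by simp)
    simp [growthField, flagField] at h1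
  have hf : ∀ {i j : ℕ}, i ≤ j → growthVector (krDist c) 0 i ≤ growthVector (krDist c) 0 j :=
    fun h => Submodule.finrank_mono (hmono h)
  have e7 : ∀ i ≤ 7, growthVector (krDist c) 0 i = i + 2 := fun i hi => by
    rw [growthVector, hsmall i hi, finrank_derivedDist_krDist c (by omega)]
  have e10 : growthVector (krDist c) 0 10 ≤ 9 :=
    (Submodule.finrank_mono (hmid 3 le_rfl)).trans (finrank_derivedDist_krDist c (by norm_num) 0).le
  have e14 : growthVector (krDist c) 0 14 ≤ 10 :=
    (Submodule.finrank_mono hlarge).trans (finrank_derivedDist_krDist c (by norm_num) 0).le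
  have e11 : growthVector (krDist c) 0 7 < growthVector (krDist c) 0 11 :=
    Submodule.finrank_lt_finrank_of_lt h11
  have e15 : growthVector (krDist c) 0 14 < growthVector (krDist c) 0 15 :=
    Submodule.finrank_lt_finrank_of_lt h15
  have emax : growthVector (krDist c) 0 i ≤ 11 := by
    simpa [growthVector] using Submodule.finrank_le (valuesAt (lieFlag (krDist c) i) (0 : Fin 11 → ℝ))
  have e := e7 7 le_rfl
  have e1114 := hf (show 11 ≤ 14 by norm_num)
  split_ifs with h1 h2 h3
  · exact e7 i h1
  · have := hf (show 7 ≤ i by omega)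
    have := hf h2
    omega
  · have := hf (show 11 ≤ i by omega)
    have := hf h3
    omega
  · have := hf (show 15 ≤ i by omega)
    omega

/-! ### Abnormal curves -/

/-- The parameter occurs only in the ∂9 component of κ₂, and ∂9 belongs to D⁽¹⁾. -/
theorem derivedFlag_krDist_succ (c c' : ℝ) (i : ℕ) :
    derivedFlag (krDist c) (i + 1) = derivedFlag (krDist c') (i + 1) := by
  induction i with
  | zero =>
    have key : ∀ c c' : ℝ, Submodule.span (smoothFunctions (Fin 11 → ℝ)) (flagGens c 1) ≤
        Submodule.span (smoothFunctions (Fin 11 → ℝ)) (flagGens c' 1) := by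
      intro c c'
      rw [Submodule.span_le]
      rintro V (rfl | ⟨j, hj, rfl⟩)
      · refine mem_span_flagGens (contDiff_flagField c 1) (f := fun _ => 1) contDiff_const
          fun x j hj => ?_
        fin_cases j <;> simp at hj <;> simp [flagField, kr₂]
      · exact coordField_mem_span c' (by omega)
    rw [derivedFlag_krDist c (by norm_num), derivedFlag_krDist c' (by norm_num)]
    exact le_antisymm (key c c') (key c' c)
  | succ i ih => rw [derivedFlag, ih, ← derivedFlag]

/-- A real function has zero derivative at almost all of its zeros. -/
theorem ae_hasDerivAt_eq_zero (h : ℝ → ℝ) :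
    ∀ᵐ t : ℝ, ∀ d, HasDerivAt h d t → h t = 0 → d = 0 := by
  set S : Set ℝ := {t | h t = 0 ∧ ∃ d, d ≠ 0 ∧ HasDerivAt h d t} with hS
  -- A zero with nonzero derivative is isolated among the zeros, so the exceptional set is discrete,
  -- hence countable and null.
  have hdisc : DiscreteTopology S := by
    rw [discreteTopology_subtype_iff]
    rintro t ⟨-, d, hd, ht⟩
    have h1 := ht.eventually_ne (c := 0) hd
    rw [← disjoint_iff, Filter.disjoint_principal_right]
    exact h1.mono fun s hs hs' => hs hs'.1
  have hc : S.Countable := (HereditarilyLindelofSpace.isLindelof S).countable hdisc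
  filter_upwards [hc.ae_notMem MeasureTheory.volume] with t ht d hd h0
  by_contra hne
  exact ht ⟨h0, d, hne, hd⟩

theorem IsAC.of_dist_le {F G : Type*} [NormedAddCommGroup F] [NormedAddCommGroup G] {f : ℝ → F}
    {g : ℝ → G} {I : Set ℝ} (hg : IsAC g I) (K : ℝ)
    (h : ∀ s t, dist (f s) (f t) ≤ K * dist (g s) (g t)) : IsAC f I := by
  intro a ha b hb
  have h1 : Filter.Tendsto _ _ _ := hg a ha b hb
  have h2 := h1.const_mul K
  rw [mul_zero] at h2
  unfold AbsolutelyContinuousOnInterval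
  refine squeeze_zero (fun E => Finset.sum_nonneg fun i _ => dist_nonneg) (fun E => ?_) h2
  rw [Finset.mul_sum]
  exact Finset.sum_le_sum fun i _ => h _ _

theorem eq_add_of_mem_krDist {c : ℝ} {x v : Fin 11 → ℝ} (hv : v ∈ krDist c x) :
    v = v 10 • kr₁ x + v 4 • kr₂ c x := by
  obtain ⟨a, b, rfl⟩ := Submodule.mem_span_pair.1 hv
  simp [kr₁, kr₂]

/-- The Hamiltonian equations of an abnormal curve, written in the frame `κ₁, κ₂`. -/
theorem hasDerivAt_of_isAbnormal {c : ℝ} {x : Fin 11 → ℝ} {k : ℕ}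
    {f : Fin k → VF 11} {u : Fin k → ℝ} {p : (Fin 11 → ℝ) →L[ℝ] ℝ} (hf : IsFrame f (krDist c))
    (hu : fderiv ℝ (fun v => hamiltonian f x p v) u = 0) :
    p (kr₁ x) = 0 ∧ p (kr₂ c x) = 0 ∧ fderiv ℝ (fun y => hamiltonian f y p u) x =
      (∑ j, u j • f j x) 4 • p.comp (fderiv ℝ (kr₂ c) x) := by
  have hpf : ∀ j, p (f j x) = 0 := by
    intro j
    let L : (Fin k → ℝ) →L[ℝ] ℝ := ∑ j, (p (f j x)) • ContinuousLinearMap.proj j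
    have hL : (fun v => hamiltonian f x p v) = L := by
      ext v
      simp [L, hamiltonian, mul_comm]
    rw [hL, L.fderiv] at hu
    have := congrArg (fun L : (Fin k → ℝ) →L[ℝ] ℝ => L (Pi.single j 1)) hu
    simpa [L, Pi.single_apply] using this
  have hker : krDist c x ≤ LinearMap.ker (p : (Fin 11 → ℝ) →ₗ[ℝ] ℝ) := by
    rw [← (hf.2 x).2, Submodule.span_le]
    rintro _ ⟨j, rfl⟩
    exact hpf j
  have h1 : p (kr₁ x) = 0 := hker (Submodule.subset_span (Or.inl rfl))
  have h2 : p (kr₂ c x) = 0 := hker (Submodule.subset_span (Or.inr rfl))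
  refine ⟨h1, h2, ?_⟩
  -- Coordinate 4 reads off the coefficient of κ₂. Since κ₁ is constant and killed by p, the
  -- Hamiltonian is B · p(κ₂) at all points y; the derivative of B drops out because p(κ₂) = 0 at x.
  -- The choice of frame thus plays no role.
  set B : (Fin 11 → ℝ) → ℝ := fun y => (∑ j, u j • f j y) 4 with hB
  have hmem : ∀ y, (∑ j, u j • f j y) ∈ krDist c y := fun y =>
    Submodule.sum_mem _ fun j _ => Submodule.smul_mem _ _ (by
      rw [← (hf.2 y).2]
      exact Submodule.subset_span ⟨j, rfl⟩)
  have hH : (fun y => hamiltonian f y p u) = fun y => B y * p (kr₂ c y) := by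
    ext y
    rw [hamiltonian, eq_add_of_mem_krDist (hmem y), map_add, map_smul, map_smul,
      show kr₁ y = kr₁ x from rfl, h1, smul_zero, zero_add, smul_eq_mul]
  have hBd : DifferentiableAt ℝ B x := by
    have : ContDiff ℝ ∞ fun y => ∑ j, u j • f j y :=
      ContDiff.sum fun j _ => (hf.1 j).const_smul (u j)
    exact (contDiff_pi.1 this 4).contDiffAt.differentiableAt (by simp)
  have hkd : DifferentiableAt ℝ (kr₂ c) x :=
    (contDiff_kr₂ c).contDiffAt.differentiableAt (by simp)
  have hpd : HasFDerivAt (fun y => p (kr₂ c y)) (p.comp (fderiv ℝ (kr₂ c) x)) x :=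
    p.hasFDerivAt.comp x hkd.hasFDerivAt
  rw [hH]
  refine (hBd.hasFDerivAt.mul hpd).fderiv.trans ?_
  rw [h2, zero_smul, add_zero]

theorem covector_apply_eq (p : (Fin 11 → ℝ) →L[ℝ] ℝ) (v : Fin 11 → ℝ) :
    p v = ∑ j, v j * p (Pi.single j 1) := by
  conv_lhs => rw [pi_eq_sum_univ' v]
  rw [map_sum]
  refine Finset.sum_congr rfl fun j _ => ?_
  rw [map_smul, smul_eq_mul]

/-- Abnormal curves in the half space `x₉ > -1` are tangent to `∂/∂x₁₁`. -/
theorem ae_deriv_eq_zero_of_isAbnormal {c : ℝ} {I : Set ℝ} {x : ℝ → Fin 11 → ℝ}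
    (h : IsAbnormal (krDist c) I x) (hx : ∀ t ∈ I, -1 < x t 8) :
    ∀ᵐ t, t ∈ I → HasDerivAt x (deriv (fun s => x s 10) t • kr₁ (x t)) t := by
  obtain ⟨-, k, f, u, p, hf, -, -, hp0, hae⟩ := h
  -- All functions to be differentiated in the cascade are listed at once. Outside one null set, a
  -- zero value at t alone forces a zero derivative at t, so no vanishing on an interval is needed.
  filter_upwards [hae, ae_hasDerivAt_eq_zero fun t => p t (Pi.single 10 1),
    ae_hasDerivAt_eq_zero fun t => p t (Pi.single 9 1),
    ae_hasDerivAt_eq_zero fun t => p t (Pi.single 8 1),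
    ae_hasDerivAt_eq_zero fun t => p t (Pi.single 7 1),
    ae_hasDerivAt_eq_zero fun t => p t (Pi.single 6 1),
    ae_hasDerivAt_eq_zero fun t => p t (Pi.single 5 1),
    ae_hasDerivAt_eq_zero fun t => p t (Pi.single 3 1),
    ae_hasDerivAt_eq_zero fun t => p t (Pi.single 2 1),
    ae_hasDerivAt_eq_zero fun t => p t (Pi.single 0 1) + x t 2 * p t (Pi.single 1 1)
      + x t 3 * p t (Pi.single 2 1) + x t 4 * p t (Pi.single 3 1),
    ae_hasDerivAt_eq_zero fun t => x t 5, ae_hasDerivAt_eq_zero fun t => x t 6,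
    ae_hasDerivAt_eq_zero fun t => x t 7] with t ht z10 z9 z8 z7 z6 z5 z3 z2 zS y5 y6 y7 htI
  obtain ⟨hxt, hpt, hut⟩ := ht htI
  obtain ⟨h1, h2, hH⟩ := hasDerivAt_of_isAbnormal hf hut
  rw [hH] at hpt
  have hmem : (∑ j, u t j • f j (x t)) ∈ krDist c (x t) :=
    Submodule.sum_mem _ fun j _ => Submodule.smul_mem _ _ (by
      rw [← (hf.2 (x t)).2]
      exact Submodule.subset_span ⟨j, rfl⟩)
  set v := ∑ j, u t j • f j (x t) with hv
  set b := v 4 with hb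
  have hxi := hasDerivAt_pi.1 hxt
  have hve := eq_add_of_mem_krDist hmem
  have hpj : ∀ w : Fin 11 → ℝ, HasDerivAt (fun s => p s w)
      (-(b * p t (fderiv ℝ (kr₂ c) (x t) w))) t := fun w => by
    have := (ContinuousLinearMap.apply ℝ ℝ w).hasFDerivAt.comp_hasDerivAt t hpt
    simpa using! this
  have hd : ∀ j : Fin 11, j ≠ 10 → v j = b * kr₂ c (x t) j := by
    intro j hj
    conv_lhs => rw [hve]
    simp [kr₁_eq, coordField, hj, hb]
  have hX : ∀ j : Fin 11, j ≠ 10 → HasDerivAt (fun s => x s j) (b * kr₂ c (x t) j) t := by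
    intro j hj
    rw [← hd j hj]
    exact hxi j
  have hsum := covector_apply_eq (p t)
  have hb0 : b = 0 := by
    -- Where the κ₂ coefficient b is nonzero, p10 = 0 forces in turn p9, p8, p7, p6, p5 and p(K) to
    -- vanish.
    by_contra hb0
    have hp : ∀ w : Fin 11 → ℝ, -(b * p t (fderiv ℝ (kr₂ c) (x t) w)) = 0 →
        p t (fderiv ℝ (kr₂ c) (x t) w) = 0 := fun w h => by
      rw [neg_eq_zero, mul_eq_zero] at h
      exact h.resolve_left hb0
    have q10 : p t (Pi.single 10 1) = 0 := by
      rw [← h1, kr₁_eq]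
      rfl
    have q9 : p t (Pi.single 9 1) = 0 := by
      have := hp _ (z10 _ (hpj _) q10)
      rw [hsum, fderiv_kr₂] at this
      simpa [Fin.sum_univ_succ] using this
    have q8 : p t (Pi.single 8 1) = 0 := by
      have := hp _ (z9 _ (hpj _) q9)
      rw [hsum, fderiv_kr₂] at this
      simpa [Fin.sum_univ_succ] using this
    have q7 : p t (Pi.single 7 1) = 0 := by
      have := hp _ (z8 _ (hpj _) q8)
      rw [hsum, fderiv_kr₂] at this
      simpa [Fin.sum_univ_succ] using this
    have q6 : p t (Pi.single 6 1) = 0 := by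
      have := hp _ (z7 _ (hpj _) q7)
      rw [hsum, fderiv_kr₂] at this
      simpa [Fin.sum_univ_succ] using this
    have q5 : p t (Pi.single 5 1) = 0 := by
      have := hp _ (z6 _ (hpj _) q6)
      rw [hsum, fderiv_kr₂] at this
      simpa [Fin.sum_univ_succ] using this
    have qS : p t (Pi.single 0 1) + x t 2 * p t (Pi.single 1 1) + x t 3 * p t (Pi.single 2 1)
        + x t 4 * p t (Pi.single 3 1) = 0 := by
      have := hp _ (z5 _ (hpj _) q5)
      rw [hsum, fderiv_kr₂] at this
      simp [Fin.sum_univ_succ] at this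
      linarith
    have q3 : p t (Pi.single 3 1) = 0 := by
      -- In the derivative of p(K) the terms with p1 and p2 cancel, and only b p3 remains.
      have hS := ((((hpj (Pi.single 0 1)).add ((hX 2 (by decide)).mul (hpj (Pi.single 1 1)))).add
        ((hX 3 (by decide)).mul (hpj (Pi.single 2 1)))).add
        ((hX 4 (by decide)).mul (hpj (Pi.single 3 1))))
      have := zS _ hS qS
      simp only [fderiv_kr₂] at this
      rw [hsum ![_, _, _, _, _, _, _, _, _, _, _], hsum ![_, _, _, _, _, _, _, _, _, _, _],
        hsum ![_, _, _, _, _, _, _, _, _, _, _], hsum ![_, _, _, _, _, _, _, _, _, _, _]] at this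
      simp [Fin.sum_univ_succ, kr₂] at this
      refine (mul_eq_zero.1 ?_).resolve_left hb0
      linear_combination this
    have q2 : x t 5 * p t (Pi.single 2 1) = 0 := by
      have := hp _ (z3 _ (hpj _) q3)
      rw [hsum, fderiv_kr₂] at this
      simpa [Fin.sum_univ_succ] using this
    -- If x5 = 0, differentiating x5, x6 and x7 leads to x8 = -1, excluded by the half space. If x5
    -- ≠ 0, the remaining components of p vanish, contradicting that p has no zeros.
    rcases eq_or_ne (x t 5) 0 with h5 | h5
    · have h6 : x t 6 = 0 := by
        simpa [hb0, kr₂] using y5 _ (hX 5 (by decide)) h5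
      have h7 : x t 7 = 0 := by
        simpa [hb0, kr₂] using y6 _ (hX 6 (by decide)) h6
      have h8 : x t 8 + 1 = 0 := by
        simpa [hb0, kr₂] using y7 _ (hX 7 (by decide)) h7
      have := hx t htI
      linarith
    · have q2 := (mul_eq_zero.1 q2).resolve_left h5
      have q1 : p t (Pi.single 1 1) = 0 := by
        have := hp _ (z2 _ (hpj _) q2)
        rw [hsum, fderiv_kr₂] at this
        simpa [Fin.sum_univ_succ, h5] using this
      have q0 : p t (Pi.single 0 1) = 0 := by
        simpa [q1, q2, q3] using qS
      have q4 : p t (Pi.single 4 1) = 0 := by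
        have := h2
        rw [hsum] at this
        simpa [Fin.sum_univ_succ, kr₂, q0, q1, q2, q3, q5, q6, q7, q8, q9, q10] using this
      apply hp0 t htI
      ext w
      rw [hsum]
      simp [Fin.sum_univ_succ, q0, q1, q2, q3, q4, q5, q6, q7, q8, q9, q10]
  have h10 : v = deriv (fun s => x s 10) t • kr₁ (x t) := by
    rw [(hxi 10).deriv]
    conv_lhs => rw [hve, ← hb, hb0, zero_smul, add_zero]
  rw [← h10]
  exact hxt

/-- The curve is tangent to ∂10, and the covector dx1 - x2 dx0 annihilates κ₁ and κ₂ for every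
parameter. It is a lift with control (ẋ10, 0), because x2 has zero derivative almost everywhere. -/
theorem isAbnormal_krDist {c c' : ℝ} {I : Set ℝ} {x : ℝ → Fin 11 → ℝ}
    (h : IsAbnormal (krDist c) I x) (hx : ∀ t ∈ I, -1 < x t 8) :
    IsAbnormal (krDist c') I x := by
  have hae := ae_deriv_eq_zero_of_isAbnormal h hx
  let pr : Fin 11 → ((Fin 11 → ℝ) →L[ℝ] ℝ) := fun j => ContinuousLinearMap.proj j
  refine ⟨h.1, 2, ![kr₁, kr₂ c'], fun t => ![deriv (fun s => x s 10) t, 0],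
    fun t => pr 1 - x t 2 • pr 0, isFrame_kr c', ?_, ?_, fun t _ h0 => ?_, ?_⟩
  · rw [measurable_pi_iff]
    intro j
    fin_cases j
    · exact measurable_deriv _
    · exact measurable_const
  · refine h.1.of_dist_le ‖pr 0‖ fun s t => ?_
    have e : pr 1 - x s 2 • pr 0 - (pr 1 - x t 2 • pr 0) = (x t 2 - x s 2) • pr 0 := by module
    rw [dist_eq_norm, e, norm_smul, mul_comm, dist_comm, dist_eq_norm]
    gcongr
    exact norm_le_pi_norm (x t - x s) 2
  · have := congrArg (fun L : (Fin 11 → ℝ) →L[ℝ] ℝ => L (Pi.single 1 1)) h0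
    simp [pr] at this
  · filter_upwards [hae] with t ht htI
    have hxt := ht htI
    refine ⟨?_, ?_, ?_⟩
    · simpa [Fin.sum_univ_two] using hxt
    · have e : (fun y => hamiltonian ![kr₁, kr₂ c'] y (pr 1 - x t 2 • pr 0)
          ![deriv (fun s => x s 10) t, 0]) = fun _ => 0 := by
        ext y
        simp [hamiltonian, Fin.sum_univ_two, pr, kr₁]
      rw [e, fderiv_const_apply, neg_zero]
      have h2 := (hasDerivAt_pi.1 hxt) 2
      have h3 : HasDerivAt (fun s => x s 2) 0 t := by simpa [kr₁] using h2
      simpa using (h3.smul_const (pr 0)).const_sub (pr 1)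
    · have e : (fun v => hamiltonian ![kr₁, kr₂ c'] (x t) (pr 1 - x t 2 • pr 0) v) =
          fun _ => 0 := by
        ext v
        simp [hamiltonian, Fin.sum_univ_two, pr, kr₁, kr₂]
        ring
      rw [e, fderiv_const_apply]

theorem sameAbnormals_krDist (c c' : ℝ) : SameAbnormals (krDist c) 0 (krDist c') 0 := by
  have hopen : IsOpen {x : Fin 11 → ℝ | -1 < x 8} :=
    isOpen_lt continuous_const (continuous_apply 8)
  refine ⟨OpenPartialHomeomorph.ofSet _ hopen, by simp, by simp, contDiffOn_id, contDiffOn_id,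
    fun i I x _ hx => ?_⟩
  have hx' : ∀ t ∈ I, -1 < x t 8 := hx
  change _ ↔ IsAbnormal (derivedDist (krDist c') i) I x
  rcases i with _ | i
  · rw [show derivedDist (krDist c) 0 = krDist c from funext (derivedDist_krDist_zero c),
      show derivedDist (krDist c') 0 = krDist c' from funext (derivedDist_krDist_zero c')]
    exact ⟨fun h => isAbnormal_krDist h hx', fun h => isAbnormal_krDist h hx'⟩
  · have : derivedDist (krDist c) (i + 1) = derivedDist (krDist c') (i + 1) := by
      ext1 p
      rw [derivedDist, derivedFlag_krDist_succ c c', ← derivedDist]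
    rw [this]

/-! ### Local equivalences -/

section LocalBracket

variable {E : Type*} [NormedAddCommGroup E] [NormedSpace ℝ E] {U : Set E}

theorem contDiffOn_fderiv_apply (hU : IsOpen U) {f : E → ℝ} (hf : ContDiffOn ℝ ∞ f U) {V : E → E}
    (hV : ContDiff ℝ ∞ V) : ContDiffOn ℝ ∞ (fun x => fderiv ℝ f x (V x)) U :=
  (hf.fderiv_of_isOpen hU (m := ∞) (by simp)).clm_apply hV.contDiffOn

theorem fderiv_lieBracket_apply (hU : IsOpen U) {f : E → ℝ} (hf : ContDiffOn ℝ ∞ f U)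
    {P Q : E → E} (hP : ContDiff ℝ ∞ P) (hQ : ContDiff ℝ ∞ Q) {x : E} (hx : x ∈ U) :
    fderiv ℝ f x (VectorField.lieBracket ℝ P Q x) =
      fderiv ℝ (fun y => fderiv ℝ f y (Q y)) x (P x) -
        fderiv ℝ (fun y => fderiv ℝ f y (P y)) x (Q x) :=
  VectorField.fderiv_apply_lieBracket (n := ∞) (hf.contDiffAt (hU.mem_nhds hx))
    (by rw [minSmoothness_of_isRCLikeNormedField]; exact WithTop.coe_le_coe.2 (le_top (a := (2 : ℕ∞))))
    (hQ.contDiffAt.differentiableAt (by simp)) (hP.contDiffAt.differentiableAt (by simp))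

theorem fderiv_mul_fderiv_apply (hU : IsOpen U) {a b g : E → ℝ} (ha : ContDiffOn ℝ ∞ a U)
    (hg : ContDiffOn ℝ ∞ g U) {Q : E → E} (hQ : ContDiff ℝ ∞ Q)
    (h : ∀ x ∈ U, fderiv ℝ b x (Q x) = g x * fderiv ℝ a x (Q x)) {x : E} (hx : x ∈ U) (v : E) :
    fderiv ℝ (fun y => fderiv ℝ b y (Q y)) x v =
      g x * fderiv ℝ (fun y => fderiv ℝ a y (Q y)) x v +
        fderiv ℝ g x v * fderiv ℝ a x (Q x) := by
  have hx' := hU.mem_nhds hx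
  have e : (fun y => fderiv ℝ b y (Q y)) =ᶠ[𝓝 x] fun y => g y * fderiv ℝ a y (Q y) :=
    Filter.eventually_of_mem hx' h
  have h1 := (hg.contDiffAt hx').differentiableAt (by simp)
  have h2 := ((contDiffOn_fderiv_apply hU ha hQ).contDiffAt hx').differentiableAt (by simp)
  rw [e.fderiv_eq, fderiv_fun_mul h1 h2]
  simp [mul_comm]

/-- The exterior derivative of `db - g da`, evaluated on two fields in its kernel. -/
theorem fderiv_lieBracket_of_eq_mul (hU : IsOpen U) {a b g : E → ℝ} (ha : ContDiffOn ℝ ∞ a U)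
    (hb : ContDiffOn ℝ ∞ b U) (hg : ContDiffOn ℝ ∞ g U) {P Q : E → E} (hP : ContDiff ℝ ∞ P)
    (hQ : ContDiff ℝ ∞ Q) (h1 : ∀ x ∈ U, fderiv ℝ b x (P x) = g x * fderiv ℝ a x (P x))
    (h2 : ∀ x ∈ U, fderiv ℝ b x (Q x) = g x * fderiv ℝ a x (Q x)) {x : E} (hx : x ∈ U) :
    fderiv ℝ b x (VectorField.lieBracket ℝ P Q x) =
      g x * fderiv ℝ a x (VectorField.lieBracket ℝ P Q x) +
        (fderiv ℝ g x (P x) * fderiv ℝ a x (Q x) - fderiv ℝ g x (Q x) * fderiv ℝ a x (P x)) := by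
  rw [fderiv_lieBracket_apply hU hb hP hQ hx, fderiv_lieBracket_apply hU ha hP hQ hx,
    fderiv_mul_fderiv_apply hU ha hg hQ h2 hx, fderiv_mul_fderiv_apply hU ha hg hP h1 hx]
  ring

end LocalBracket

/-- `φ` maps the distribution with parameter `c` to that with parameter `c'` over `U`. -/
structure MapsKr (c c' : ℝ) (φ : VF 11) (U : Set (Fin 11 → ℝ)) : Prop where
  isOpen : IsOpen U
  contDiffOn : ContDiffOn ℝ ∞ φ U
  injective : ∀ x ∈ U, Function.Injective (fderiv ℝ φ x)
  mapsTo : ∀ x ∈ U, ∀ v ∈ krDist c x, fderiv ℝ φ x v ∈ krDist c' (φ x)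

/-- The indices `a`, `b` of the `r`-th Pfaffian equation `dx_b = (x_{10-r} + const) dx_a`. -/
def pfaffSource (r : ℕ) : Fin 11 := if r ≤ 5 then 4 else 0

/-- The index `b` of the `r`-th Pfaffian equation `dx_b = (x_{10-r} + const) dx_a`. -/
def pfaffTarget : ℕ → Fin 11
  | 0 => 9
  | 1 => 8
  | 2 => 7
  | 3 => 6
  | 4 => 5
  | 5 => 0
  | 6 => 3
  | 7 => 2
  | _ => 1

/-- The constant in the `r`-th Pfaffian equation `dx_b = (x_{10-r} + const) dx_a`. -/
def pfaffConst (c : ℝ) : ℕ → ℝ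
  | 0 => c
  | 1 => 1
  | 2 => 1
  | _ => 0

theorem clm_apply_eq_mul {L : (Fin 11 → ℝ) →L[ℝ] ℝ} {m : ℕ}
    (hL : ∀ j : Fin 11, m ≤ (j : ℕ) → L (Pi.single j 1) = 0) {w K : Fin 11 → ℝ} {a : ℝ}
    (h : ∀ j : Fin 11, (j : ℕ) < m → w j = a * K j) : L w = a * L K := by
  rw [covector_apply_eq L w, covector_apply_eq L K, Finset.mul_sum]
  refine Finset.sum_congr rfl fun j _ => ?_
  rcases Nat.lt_or_ge j m with hj | hj
  · rw [h j hj, mul_assoc]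
  · rw [hL j hj, mul_zero, mul_zero, mul_zero]

/-! ### Pulled-back Pfaffian equations and characteristic directions. -/

namespace MapsKr

variable {c c' : ℝ} {φ : VF 11} {U : Set (Fin 11 → ℝ)}

theorem contDiffOn_apply (h : MapsKr c c' φ U) (m : Fin 11) :
    ContDiffOn ℝ ∞ (fun x => φ x m) U := contDiffOn_pi.1 h.contDiffOn m

theorem fderiv_apply (h : MapsKr c c' φ U) {x : Fin 11 → ℝ} (hx : x ∈ U) (v : Fin 11 → ℝ)
    (m : Fin 11) : fderiv ℝ (fun y => φ y m) x v = fderiv ℝ φ x v m :=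
  (fderiv_pi_apply ((h.contDiffOn.contDiffAt (h.isOpen.mem_nhds hx)).differentiableAt
    (by simp)) v m).symm

theorem pfaff_of_mem_krDist {y v : Fin 11 → ℝ} (hv : v ∈ krDist c' y) {r : ℕ} (hr : r ≤ 8) :
    v (pfaffTarget r) = (y ⟨10 - r, by omega⟩ + pfaffConst c' r) * v (pfaffSource r) := by
  rw [eq_add_of_mem_krDist hv]
  interval_cases r <;> simp [pfaffTarget, pfaffConst, pfaffSource, kr₁, kr₂] <;> ring

/-- A dual form of the functoriality of the derived flag: D⁽ⁱ⁾ satisfies the pulled-back equations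
of index r ≥ i. Working with equations avoids pushing forward global sections by a map that is
controlled only on `U`. -/
theorem pfaff_of_mem_derivedFlag (h : MapsKr c c' φ U) {i : ℕ} (hi : i ≤ 8) {V : VF 11}
    (hV : V ∈ derivedFlag (krDist c) i) {x : Fin 11 → ℝ} (hx : x ∈ U) {r : ℕ} (hir : i ≤ r)
    (hr : r ≤ 8) :
    fderiv ℝ (fun y => φ y (pfaffTarget r)) x (V x) =
      (φ x ⟨10 - r, by omega⟩ + pfaffConst c' r) *
        fderiv ℝ (fun y => φ y (pfaffSource r)) x (V x) := by
  induction i generalizing V x r with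
  | zero =>
    rw [h.fderiv_apply hx, h.fderiv_apply hx]
    exact pfaff_of_mem_krDist (h.mapsTo x hx _ (hV.2 x)) hr
  | succ i ih =>
    have hsm : ∀ W ∈ derivedFlag (krDist c) i, ContDiff ℝ ∞ W := fun W hW => by
      rw [derivedFlag_krDist c (by omega)] at hW
      exact contDiff_of_mem_span contDiff_of_mem_flagGens hW
    rw [derivedFlag, Submodule.mem_sup] at hV
    obtain ⟨V₁, hV₁, V₂, hV₂, rfl⟩ := hV
    have e1 := ih (by omega) hV₁ hx (by omega) hr
    suffices e2 : fderiv ℝ (fun y => φ y (pfaffTarget r)) x (V₂ x) =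
        (φ x ⟨10 - r, by omega⟩ + pfaffConst c' r) *
          fderiv ℝ (fun y => φ y (pfaffSource r)) x (V₂ x) by
      rw [Pi.add_apply, map_add, map_add, e1, e2]
      ring
    unfold bracket at hV₂
    induction hV₂ using Submodule.span_induction with
    | mem Z hZ =>
      obtain ⟨P, hP, Q, hQ, rfl⟩ := hZ
      have := fderiv_lieBracket_of_eq_mul h.isOpen (h.contDiffOn_apply (pfaffSource r))
        (h.contDiffOn_apply (pfaffTarget r))
        ((h.contDiffOn_apply ⟨10 - r, by omega⟩).add contDiffOn_const) (hsm P hP) (hsm Q hQ)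
        (fun x hx => ih (by omega) hP hx (by omega) hr)
        (fun x hx => ih (by omega) hQ hx (by omega) hr) hx
      rw [this]
      -- Equation r - 1 relates the coefficient φ(10-r) and the source function of equation r, so
      -- their differentials are proportional on P and Q and the 2×2 determinant vanishes. At r = 6
      -- the two exchange roles: the equation used is dφ0 = φ5 dφ4.
      have eP := ih (by omega) hP hx (r := r - 1) (by omega) (by omega)
      have eQ := ih (by omega) hQ hx (r := r - 1) (by omega) (by omega)
      have e0 : ∀ (k : Fin 11) (κ : ℝ), fderiv ℝ (fun y => φ y k + κ) x =
          fderiv ℝ (fun y => φ y k) x := fun k κ => fderiv_add_const _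
      rw [e0]
      have hr1 : 1 ≤ r := by omega
      clear this e1 hP hQ ih
      interval_cases r <;> simp only [pfaffTarget, pfaffSource, pfaffConst] at eP eQ ⊢ <;>
        simp at eP eQ ⊢ <;> rw [eP, eQ] <;> ring
    | zero => simp
    | add V W _ _ hV hW =>
      rw [Pi.add_apply, map_add, map_add, hV, hW]
      ring
    | smul f W _ hW =>
      change fderiv ℝ _ x (f.1 x • W x) = _ * fderiv ℝ _ x (f.1 x • W x)
      rw [map_smul, map_smul, hW, smul_eq_mul, smul_eq_mul]
      ring

theorem pfaff_of_mem_derivedDist (h : MapsKr c c' φ U) {i : ℕ} (hi : i ≤ 8)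
    {x : Fin 11 → ℝ} (hx : x ∈ U) {v : Fin 11 → ℝ} (hv : v ∈ derivedDist (krDist c) i x) {r : ℕ}
    (hir : i ≤ r) (hr : r ≤ 8) :
    fderiv ℝ (fun y => φ y (pfaffTarget r)) x v =
      (φ x ⟨10 - r, by omega⟩ + pfaffConst c' r) *
        fderiv ℝ (fun y => φ y (pfaffSource r)) x v := by
  unfold derivedDist valuesAt at hv
  induction hv using Submodule.span_induction with
  | mem v hv =>
    obtain ⟨V, hV, rfl⟩ := hv
    exact h.pfaff_of_mem_derivedFlag hi hV hx hir hr
  | zero => simp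
  | add v w _ _ hv hw =>
    rw [map_add, map_add, hv, hw]
    ring
  | smul a w _ hw =>
    rw [map_smul, map_smul, hw, smul_eq_mul, smul_eq_mul]
    ring

/-- The equations of index at least r cut out the target distribution, giving one inclusion; equal
ranks and injectivity of the differential give the other. -/
theorem map_derivedDist (h : MapsKr c c' φ U) {r : ℕ} (h6 : 6 ≤ r) (h8 : r ≤ 8)
    {x : Fin 11 → ℝ} (hx : x ∈ U) :
    (derivedDist (krDist c) r x).map (fderiv ℝ φ x : (Fin 11 → ℝ) →ₗ[ℝ] (Fin 11 → ℝ)) =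
      derivedDist (krDist c') r (φ x) := by
  apply Submodule.eq_of_le_of_finrank_eq
  · rintro _ ⟨v, hv, rfl⟩
    have key := fun r' (h1 : r ≤ r') (h2 : r' ≤ 8) =>
      h.pfaff_of_mem_derivedDist h8 hx hv (r := r') h1 h2
    rw [mem_derivedDist_krDist (by omega)]
    refine ⟨fderiv ℝ φ x v 0, fun j hj => ?_⟩
    simp only [ContinuousLinearMap.coe_coe, ← h.fderiv_apply hx]
    have k8 := key 8 h8 le_rfl
    have k7 := fun h => key 7 h (by norm_num)
    have k6 := fun h => key 6 h (by norm_num)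
    simp [pfaffTarget, pfaffSource, pfaffConst] at k6 k7 k8
    interval_cases r <;> simp at k6 k7 <;> fin_cases j <;> simp at hj <;>
      simp [flagField, mul_comm] <;> first | exact k8 | exact k7 | exact k6
  · rw [← (Submodule.equivMapOfInjective (fderiv ℝ φ x : (Fin 11 → ℝ) →ₗ[ℝ] (Fin 11 → ℝ))
      (h.injective x hx) _).finrank_eq, finrank_derivedDist_krDist c (by omega), finrank_derivedDist_krDist c' (by omega)]

theorem exists_mem_derivedDist (h : MapsKr c c' φ U) {r : ℕ} (h6 : 6 ≤ r) (h8 : r ≤ 8)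
    {x : Fin 11 → ℝ} (hx : x ∈ U) {u : Fin 11 → ℝ} (hu : u ∈ derivedDist (krDist c') r (φ x)) :
    ∃ w ∈ derivedDist (krDist c) r x, ∀ m, fderiv ℝ (fun y => φ y m) x w = u m := by
  rw [← h.map_derivedDist h6 h8 hx] at hu
  obtain ⟨w, hw, rfl⟩ := hu
  exact ⟨w, hw, fun m => h.fderiv_apply hx w m⟩

theorem lieBracket_coordField_mem_derivedFlag (c : ℝ) {r : ℕ} (hr : r ≤ 8) {j : Fin 11}
    (hj : 11 ≤ r + j) {V : VF 11} (hV : V ∈ derivedFlag (krDist c) r) :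
    VectorField.lieBracket ℝ (coordField j) V ∈ derivedFlag (krDist c) r := by
  rw [derivedFlag_krDist c (by omega)] at hV ⊢
  refine lieBracket_mem_of_mem_span (T := {coordField j}) contDiff_of_mem_flagGens ?_
    Submodule.subset_span ?_ ?_ (Submodule.mem_span_singleton_self _) hV
  · rintro _ rfl
    exact contDiff_coordField j
  · rintro _ rfl
    exact coordField_mem_span c (by omega)
  · rintro _ rfl W (rfl | ⟨k, hk, rfl⟩)
    · exact lieBracket_coordField_flagField_mem_self c hr hj
    · rw [lieBracket_coordField_coordField]
      exact Submodule.zero_mem _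

theorem coordField_apply_mem (c : ℝ) {r : ℕ} (hr : r ≤ 9) {j : Fin 11} (hj : 10 ≤ r + j)
    (x : Fin 11 → ℝ) : (Pi.single j 1 : Fin 11 → ℝ) ∈ derivedDist (krDist c) r x :=
  flagGens_apply_mem c hr (Or.inr (coordField_mem (by omega))) x

/-- Characteristic directions pair trivially with the derived distribution. -/
theorem fderiv_mul_eq_of_characteristic (h : MapsKr c c' φ U) {r : ℕ} (h6 : 6 ≤ r) (h8 : r ≤ 8)
    {j : Fin 11} (hj : 11 ≤ r + j) {x : Fin 11 → ℝ} (hx : x ∈ U) {w : Fin 11 → ℝ}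
    (hw : w ∈ derivedDist (krDist c) r x) :
    fderiv ℝ (fun y => φ y ⟨10 - r, by omega⟩) x (Pi.single j 1) *
        fderiv ℝ (fun y => φ y 0) x w =
      fderiv ℝ (fun y => φ y ⟨10 - r, by omega⟩) x w *
        fderiv ℝ (fun y => φ y 0) x (Pi.single j 1) := by
  have hs : pfaffSource r = 0 := by simp [pfaffSource]; omega
  unfold derivedDist valuesAt at hw
  induction hw using Submodule.span_induction with
  | mem w hw =>
    obtain ⟨V, hV, rfl⟩ := hw
    have hjm : coordField j ∈ derivedFlag (krDist c) r := by
      rw [derivedFlag_krDist c (by omega)]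
      exact coordField_mem_span c (by omega)
    have hVs : ContDiff ℝ ∞ V := by
      rw [derivedFlag_krDist c (by omega)] at hV
      exact contDiff_of_mem_span contDiff_of_mem_flagGens hV
    have e1 := fderiv_lieBracket_of_eq_mul h.isOpen (h.contDiffOn_apply (pfaffSource r))
        (h.contDiffOn_apply (pfaffTarget r))
        ((h.contDiffOn_apply ⟨10 - r, by omega⟩).add contDiffOn_const)
        (contDiff_coordField j) hVs
        (fun x hx => h.pfaff_of_mem_derivedFlag h8 hjm hx le_rfl h8)
        (fun x hx => h.pfaff_of_mem_derivedFlag h8 hV hx le_rfl h8) hx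
    have e2 := h.pfaff_of_mem_derivedFlag h8
      (lieBracket_coordField_mem_derivedFlag c h8 hj hV) hx le_rfl h8
    -- The bracket of a characteristic field with V stays in the distribution, so the pulled-back
    -- equation holds for it too and the determinant term must vanish.
    rw [e2, left_eq_add, sub_eq_zero] at e1
    have e0 : ∀ (k : Fin 11) (κ : ℝ), fderiv ℝ (fun y => φ y k + κ) x =
        fderiv ℝ (fun y => φ y k) x := fun k κ => fderiv_add_const _
    rw [e0, hs] at e1
    exact e1
  | zero => simp
  | add v w _ _ hv hw =>
    rw [map_add, map_add, mul_add, add_mul, hv, hw]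
  | smul a w _ hw =>
    rw [map_smul, map_smul, smul_eq_mul, smul_eq_mul]
    linear_combination a * hw

/-- The characteristic identity for r = 8 is tested on a vector w sent to ∂2, for which dφ0(w) = 0
and dφ2(w) = 1. -/
theorem fderiv_zero_coord (h : MapsKr c c' φ U) {j : Fin 11} (hj : 3 ≤ (j : ℕ))
    {x : Fin 11 → ℝ} (hx : x ∈ U) : fderiv ℝ (fun y => φ y 0) x (Pi.single j 1) = 0 := by
  obtain ⟨w, hw, hwm⟩ := h.exists_mem_derivedDist (r := 8) (by norm_num) le_rfl hx
    (coordField_apply_mem c' (j := 2) (by norm_num) (by simp) (φ x))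
  have := h.fderiv_mul_eq_of_characteristic (by norm_num) le_rfl (by omega) hx hw (j := j)
  rw [hwm, show (⟨10 - 8, by omega⟩ : Fin 11) = 2 from rfl, hwm] at this
  simpa using this.symm

theorem exists_fderiv_zero_eq_one (h : MapsKr c c' φ U) {r : ℕ} (h6 : 6 ≤ r) (h8 : r ≤ 8)
    {x : Fin 11 → ℝ} (hx : x ∈ U) :
    ∃ w ∈ derivedDist (krDist c) r x, fderiv ℝ (fun y => φ y 0) x w = 1 := by
  obtain ⟨w, hw, hwm⟩ := h.exists_mem_derivedDist h6 h8 hx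
    (flagGens_apply_mem c' (by omega) (Set.mem_insert _ _) (φ x))
  refine ⟨w, hw, (hwm 0).trans ?_⟩
  interval_cases r <;> rfl

/-- The characteristic identity for r = 7, tested on w with dφ0(w) = 1; the other side vanishes by
`fderiv_zero_coord`. -/
theorem fderiv_three_coord (h : MapsKr c c' φ U) {j : Fin 11} (hj : 4 ≤ (j : ℕ))
    {x : Fin 11 → ℝ} (hx : x ∈ U) : fderiv ℝ (fun y => φ y 3) x (Pi.single j 1) = 0 := by
  obtain ⟨w, hw, hw1⟩ := h.exists_fderiv_zero_eq_one (r := 7) (by norm_num) (by norm_num) hx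
  have := h.fderiv_mul_eq_of_characteristic (by norm_num) (by norm_num) (by omega) hx hw (j := j)
  rw [hw1, h.fderiv_zero_coord (by omega) hx] at this
  simpa using! this

theorem fderiv_zero_six_ne_zero (h : MapsKr c c' φ U) {x : Fin 11 → ℝ} (hx : x ∈ U) :
    fderiv ℝ (fun y => φ y 0) x (flagField c 6 x) ≠ 0 := by
  obtain ⟨w, hw, hw1⟩ := h.exists_fderiv_zero_eq_one (r := 6) (by norm_num) (by norm_num) hx
  rw [mem_derivedDist_krDist (by norm_num)] at hw
  obtain ⟨a, ha⟩ := hw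
  rw [clm_apply_eq_mul (m := 4) (fun j hj => h.fderiv_zero_coord (by omega) hx) ha] at hw1
  exact right_ne_zero_of_mul_eq_one hw1

end MapsKr

/-! ### Taylor expansions along a curve -/

section Taylor

open Asymptotics

/-- The mean value inequality on the interval of radius |t|, where f' is bounded by C|t|ⁿ. -/
theorem isBigO_pow_succ_of_hasDerivAt {f f' : ℝ → ℝ} {n : ℕ}
    (hf : ∀ᶠ t in 𝓝 0, HasDerivAt f (f' t) t) (h0 : f 0 = 0)
    (hO : f' =O[𝓝 0] fun t => t ^ n) : f =O[𝓝 0] fun t => t ^ (n + 1) := by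
  obtain ⟨C, hC⟩ := hO.bound
  obtain ⟨ε, hε, hball⟩ := Metric.eventually_nhds_iff.1 (hf.and hC)
  refine IsBigO.of_bound C ?_
  filter_upwards [Metric.ball_mem_nhds (0 : ℝ) hε] with t ht
  have hs : ∀ s ∈ Metric.closedBall (0 : ℝ) |t|, dist s 0 < ε := fun s hs =>
    lt_of_le_of_lt (by simpa using hs) (by simpa using ht)
  have hb : ∀ s ∈ Metric.closedBall (0 : ℝ) |t|, ‖f' s‖ ≤ C * |t| ^ n := by
    intro s hs'
    have h1 := (hball (hs s hs')).2
    have hst : |s| ≤ |t| := by simpa using hs'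
    have h2 : ‖s ^ n‖ ≤ |t| ^ n := by
      rw [norm_pow, Real.norm_eq_abs]
      gcongr
    rcases le_or_gt 0 C with hC0 | hC0
    · exact h1.trans (by gcongr)
    -- The bound comes with no sign for C; a negative C is compatible with it only if tⁿ = 0.
    · have h3 : C * ‖t ^ n‖ ≥ 0 := (norm_nonneg _).trans
        ((hball (hs t (by simp))).2)
      have h4 : ‖t ^ n‖ = 0 := by nlinarith [norm_nonneg (t ^ n)]
      rw [norm_pow, Real.norm_eq_abs] at h4
      have h5 : ‖s ^ n‖ = 0 := le_antisymm (h2.trans h4.le) (norm_nonneg _)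
      rw [h5] at h1
      rw [h4]
      exact h1
  have := (convex_closedBall (0 : ℝ) |t|).norm_image_sub_le_of_norm_hasDerivWithin_le
    (f := f) (f' := f') (C := C * |t| ^ n) (x := 0) (y := t)
    (fun s hs' => ((hball (hs s hs')).1).hasDerivWithinAt) hb (by simp) (by simp)
  rw [h0, sub_zero, sub_zero] at this
  rw [norm_pow, Real.norm_eq_abs t]
  rw [Real.norm_eq_abs t] at this
  calc ‖f t‖ ≤ C * |t| ^ n * |t| := this
    _ = C * |t| ^ (n + 1) := by ring

/-- Integration of an expansion. -/
theorem isBigO_sub_of_hasDerivAt {f f' q q' : ℝ → ℝ} {n : ℕ}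
    (hf : ∀ᶠ t in 𝓝 0, HasDerivAt f (f' t) t) (hq : ∀ t, HasDerivAt q (q' t) t)
    (h0 : f 0 = 0) (hq0 : q 0 = 0) (hO : (fun t => f' t - q' t) =O[𝓝 0] fun t => t ^ n) :
    (fun t => f t - q t) =O[𝓝 0] fun t => t ^ (n + 1) :=
  isBigO_pow_succ_of_hasDerivAt (hf.mono fun t ht => ht.sub (hq t)) (by rw [h0, hq0, sub_zero]) hO

theorem isBigO_pow_mul_of_le {r : ℝ → ℝ} (hr : ContinuousAt r 0) {m n : ℕ} (h : n ≤ m) :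
    (fun t => t ^ m * r t) =O[𝓝 0] fun t => t ^ n := by
  have h1 : (fun t => t ^ (m - n) * r t) =O[𝓝 0] fun _ => (1 : ℝ) :=
    ((continuous_pow (m - n)).continuousAt.mul hr).isBigO_one ℝ
  refine ((isBigO_refl (fun t : ℝ => t ^ n) (𝓝 0)).mul h1).congr (fun t => ?_) fun t => mul_one _
  rw [← mul_assoc, ← pow_add, Nat.add_sub_cancel' h]

/-- Multiplication of an expansion with a function that is constant up to third order. -/
theorem isBigO_mul_sub_mul_const {f q r δ : ℝ → ℝ} {δ₀ : ℝ} {n k : ℕ}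
    (hf : (fun t => f t - q t) =O[𝓝 0] fun t => t ^ n)
    (hδ : (fun t => δ t - δ₀) =O[𝓝 0] fun t => t ^ 3)
    (hr : Continuous r) (hq : ∀ t, q t = t ^ k * r t) (hn : n ≤ k + 3) :
    (fun t => f t * δ t - q t * δ₀) =O[𝓝 0] fun t => t ^ n := by
  have hδ1 : δ =O[𝓝 0] fun _ => (1 : ℝ) := by
    have h1 : (fun t : ℝ => t ^ 3) =O[𝓝 0] fun _ => (1 : ℝ) :=
      (continuous_pow 3).continuousAt.isBigO_one ℝ
    simpa using (hδ.trans h1).add (isBigO_refl (fun _ => δ₀) (𝓝 (0 : ℝ)) |>.trans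
      (isBigO_const_one ℝ δ₀ _))
  have h1 := hf.mul hδ1
  have h2 := ((isBigO_refl q (𝓝 0)).mul hδ).trans (((isBigO_pow_mul_of_le hr.continuousAt hn)).congr_left
    fun t => show t ^ (k + 3) * r t = q t * t ^ 3 by rw [hq]; ring)
  refine ((h1.congr_right fun t => mul_one _).add h2).congr_left fun t => ?_
  ring

theorem apply_zero_eq_zero_of_isBigO_pow {f : ℝ → ℝ} {m n : ℕ} (hf : Continuous f) (hmn : m < n)
    (h : (fun t => t ^ m * f t) =O[𝓝 0] fun t => t ^ n) : f 0 = 0 := by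
  have h' := h.trans (((isBigO_pow_mul_of_le (r := fun _ => 1) continuousAt_const hmn).congr_left
    fun t => mul_one _))
  obtain ⟨C, hC⟩ := h'.bound
  have h1 : Filter.Tendsto f (𝓝[≠] 0) (𝓝 (f 0)) := hf.continuousAt.mono_left nhdsWithin_le_nhds
  have h2 : Filter.Tendsto f (𝓝[≠] 0) (𝓝 0) := by
    have h3 : Filter.Tendsto (fun t : ℝ => C * |t|) (𝓝[≠] 0) (𝓝 0) := by
      have : Continuous fun t : ℝ => C * |t| := by fun_prop
      simpa using (this.tendsto 0).mono_left nhdsWithin_le_nhds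
    refine squeeze_zero_norm' ?_ h3
    filter_upwards [nhdsWithin_le_nhds hC, self_mem_nhdsWithin] with t ht ht0
    have hpos : 0 < |t| ^ m := pow_pos (abs_pos.2 ht0) m
    rw [norm_mul, norm_pow, norm_pow, Real.norm_eq_abs t, pow_succ] at ht
    have : |t| ^ m * ‖f t‖ ≤ |t| ^ m * (C * |t|) := by linarith
    exact le_of_mul_le_mul_left this hpos
  exact tendsto_nhds_unique h1 h2

theorem hasDerivAt_quintic (a₁ a₂ a₃ a₄ a₅ t : ℝ) :
    HasDerivAt (fun t => a₁ * t + a₂ * t ^ 2 + a₃ * t ^ 3 + a₄ * t ^ 4 + a₅ * t ^ 5)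
      (a₁ + 2 * a₂ * t + 3 * a₃ * t ^ 2 + 4 * a₄ * t ^ 3 + 5 * a₅ * t ^ 4) t := by
  have h := fun n => hasDerivAt_pow n t
  refine ((((((hasDerivAt_id t).const_mul a₁).add ((h 2).const_mul a₂)).add
    ((h 3).const_mul a₃)).add ((h 4).const_mul a₄)).add ((h 5).const_mul a₅)).congr_deriv ?_
  simp
  ring

/-- Comparison of the fifth order Taylor expansions of a tower of functions. -/
theorem parameter_eq_of_tower {c c' δ₀ G₀ : ℝ} {f₅ f₆ f₇ f₈ f₉ f₁₀ δ G : ℝ → ℝ}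
    (h₅ : ∀ᶠ t in 𝓝 0, HasDerivAt f₅ (f₆ t * δ t) t)
    (h₆ : ∀ᶠ t in 𝓝 0, HasDerivAt f₆ (f₇ t * δ t) t)
    (h₇ : ∀ᶠ t in 𝓝 0, HasDerivAt f₇ ((f₈ t + 1) * δ t) t)
    (h₈ : ∀ᶠ t in 𝓝 0, HasDerivAt f₈ ((f₉ t + 1) * δ t) t)
    (h₉ : ∀ᶠ t in 𝓝 0, HasDerivAt f₉ ((f₁₀ t + c') * δ t) t)
    (h₁₀ : DifferentiableAt ℝ f₁₀ 0) (z₅ : f₅ 0 = 0) (z₆ : f₆ 0 = 0) (z₇ : f₇ 0 = 0)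
    (z₈ : f₈ 0 = 0) (z₉ : f₉ 0 = 0) (z₁₀ : f₁₀ 0 = 0)
    (hδ : (fun t => δ t - δ₀) =O[𝓝 0] fun t => t ^ 3)
    (hG : (fun t => G t - G₀) =O[𝓝 0] fun t => t ^ 3) (hG₀ : G₀ ≠ 0)
    (h : ∀ᶠ t in 𝓝 0, f₅ t * δ t = (t ^ 3 / 6 + t ^ 4 / 24 + c * t ^ 5 / 120) * G t) :
    c = c' := by
  -- Only first order vanishing of f₁₀ is available. Each integration gains one order, so this
  -- unknown reaches f₅ only in O(t⁶), beyond the t⁵ term that carries c'.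
  have o₁₀ : (fun t => f₁₀ t - 0) =O[𝓝 0] fun t => t ^ 1 := by
    simpa [z₁₀] using h₁₀.isBigO_sub
  have e₉ := isBigO_mul_sub_mul_const (f := fun t => f₁₀ t + c') (q := fun _ => c')
    (r := fun _ => c') (k := 0) (o₁₀.congr_left fun t => by ring) hδ continuous_const
    (fun t => by ring) (by norm_num)
  have o₉ := isBigO_sub_of_hasDerivAt h₉ (hasDerivAt_quintic (c' * δ₀) 0 0 0 0) z₉ (by simp)
    (e₉.congr_left fun t => by ring)
  have e₈ := isBigO_mul_sub_mul_const (f := fun t => f₉ t + 1) (q := fun t => c' * δ₀ * t + 1)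
    (r := fun t => c' * δ₀ * t + 1) (k := 0) (o₉.congr_left fun t => by ring) hδ (by fun_prop)
    (fun t => by ring) (by norm_num)
  have o₈ := isBigO_sub_of_hasDerivAt h₈ (hasDerivAt_quintic δ₀ (c' * δ₀ ^ 2 / 2) 0 0 0) z₈
    (by simp) (e₈.congr_left fun t => by ring)
  have e₇ := isBigO_mul_sub_mul_const (f := fun t => f₈ t + 1)
    (q := fun t => δ₀ * t + c' * δ₀ ^ 2 / 2 * t ^ 2 + 1)
    (r := fun t => δ₀ * t + c' * δ₀ ^ 2 / 2 * t ^ 2 + 1) (k := 0) (o₈.congr_left fun t => by ring)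
    hδ (by fun_prop) (fun t => by ring) (by norm_num)
  have o₇ := isBigO_sub_of_hasDerivAt h₇
    (hasDerivAt_quintic δ₀ (δ₀ ^ 2 / 2) (c' * δ₀ ^ 3 / 6) 0 0) z₇
    (by simp) (e₇.congr_left fun t => by ring)
  have e₆ := isBigO_mul_sub_mul_const (f := f₇)
    (q := fun t => δ₀ * t + δ₀ ^ 2 / 2 * t ^ 2 + c' * δ₀ ^ 3 / 6 * t ^ 3)
    (r := fun t => δ₀ + δ₀ ^ 2 / 2 * t + c' * δ₀ ^ 3 / 6 * t ^ 2) (k := 1)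
    (o₇.congr_left fun t => by ring) hδ (by fun_prop) (fun t => by ring) (by norm_num)
  have o₆ := isBigO_sub_of_hasDerivAt h₆
    (hasDerivAt_quintic 0 (δ₀ ^ 2 / 2) (δ₀ ^ 3 / 6) (c' * δ₀ ^ 4 / 24) 0) z₆
    (by simp) (e₆.congr_left fun t => by ring)
  have e₅ := isBigO_mul_sub_mul_const (f := f₆)
    (q := fun t => δ₀ ^ 2 / 2 * t ^ 2 + δ₀ ^ 3 / 6 * t ^ 3 + c' * δ₀ ^ 4 / 24 * t ^ 4)
    (r := fun t => δ₀ ^ 2 / 2 + δ₀ ^ 3 / 6 * t + c' * δ₀ ^ 4 / 24 * t ^ 2) (k := 2)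
    (o₆.congr_left fun t => by ring) hδ (by fun_prop) (fun t => by ring) (by norm_num)
  have o₅ := isBigO_sub_of_hasDerivAt h₅
    (hasDerivAt_quintic 0 0 (δ₀ ^ 3 / 6) (δ₀ ^ 4 / 24) (c' * δ₀ ^ 5 / 120)) z₅
    (by simp) (e₅.congr_left fun t => by ring)
  have eL := isBigO_mul_sub_mul_const (f := f₅)
    (q := fun t => δ₀ ^ 3 / 6 * t ^ 3 + δ₀ ^ 4 / 24 * t ^ 4 + c' * δ₀ ^ 5 / 120 * t ^ 5)
    (r := fun t => δ₀ ^ 3 / 6 + δ₀ ^ 4 / 24 * t + c' * δ₀ ^ 5 / 120 * t ^ 2) (k := 3)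
    (o₅.congr_left fun t => by ring) hδ (by fun_prop) (fun t => by ring) (by norm_num)
  have eR := isBigO_mul_sub_mul_const (n := 6)
    (f := fun t => t ^ 3 / 6 + t ^ 4 / 24 + c * t ^ 5 / 120)
    (q := fun t => t ^ 3 / 6 + t ^ 4 / 24 + c * t ^ 5 / 120)
    (r := fun t => 1 / 6 + t / 24 + c * t ^ 2 / 120) (k := 3)
    (by simpa using isBigO_zero _ _) hG (by fun_prop) (fun t => by ring) (by norm_num)
  -- The two expansions of the common value f₅ δ; its coefficients of orders 3, 4, 5 are read off
  -- one after the other.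
  have key : (fun t : ℝ => t ^ 3 * ((δ₀ ^ 4 - G₀) / 6 + (δ₀ ^ 5 - G₀) / 24 * t +
      (c' * δ₀ ^ 6 - c * G₀) / 120 * t ^ 2)) =O[𝓝 0] fun t => t ^ 6 := by
    refine (eR.sub eL).congr' (h.mono fun t ht => ?_) Filter.EventuallyEq.rfl
    simp only
    rw [ht]
    ring
  have k₃ : (δ₀ ^ 4 - G₀) / 6 = 0 := by
    simpa using apply_zero_eq_zero_of_isBigO_pow (by fun_prop) (by norm_num) key
  have k₄ : (δ₀ ^ 5 - G₀) / 24 = 0 := by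
    have := apply_zero_eq_zero_of_isBigO_pow (m := 4)
      (f := fun t => (δ₀ ^ 5 - G₀) / 24 + (c' * δ₀ ^ 6 - c * G₀) / 120 * t) (by fun_prop)
      (by norm_num) (key.congr_left fun t => by rw [k₃]; ring)
    simpa using this
  have k₅ : (c' * δ₀ ^ 6 - c * G₀) / 120 = 0 := by
    have := apply_zero_eq_zero_of_isBigO_pow (m := 5)
      (f := fun _ => (c' * δ₀ ^ 6 - c * G₀) / 120) (by fun_prop)
      (by norm_num) (key.congr_left fun t => by rw [k₃, k₄]; ring)
    simpa using this
  have hδ1 : δ₀ = 1 := by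
    have h1 : δ₀ ^ 4 * (δ₀ - 1) = 0 := by linear_combination 24 * k₄ - 6 * k₃
    rcases mul_eq_zero.1 h1 with h2 | h2
    · exact absurd (by linear_combination h2 - 6 * k₃) hG₀
    · linarith
  have hG1 : G₀ = 1 := by
    rw [hδ1] at k₃
    linarith
  rw [hδ1, hG1] at k₅
  linarith

end Taylor

/-! ### The parameter is an invariant -/

theorem exists_hasDerivAt_of_continuous {g : ℝ → ℝ} (hg : Continuous g) :
    ∃ G : ℝ → ℝ, G 0 = 0 ∧ ∀ t, HasDerivAt G (g t) t :=
  ⟨fun t => ∫ s in (0 : ℝ)..t, g s, intervalIntegral.integral_same,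
    fun t => (hg.integral_hasStrictDerivAt 0 t).hasDerivAt⟩

/-- The integral curve of `κ₂` through the origin. -/
theorem exists_integralCurve (c : ℝ) : ∃ γ : ℝ → Fin 11 → ℝ, γ 0 = 0 ∧
    (∀ t, HasDerivAt γ (kr₂ c (γ t)) t) ∧
    ∀ t, γ t 5 = t ^ 3 / 6 + t ^ 4 / 24 + c * t ^ 5 / 120 := by
  set P : ℝ → ℝ := fun t => t ^ 3 / 6 + t ^ 4 / 24 + c * t ^ 5 / 120 with hP
  have hPc : Continuous P := by fun_prop
  have hcont : ∀ {f f' : ℝ → ℝ}, (∀ t, HasDerivAt f (f' t) t) → Continuous f := fun h =>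
    continuous_iff_continuousAt.2 fun t => (h t).continuousAt
  obtain ⟨y₀, z₀, h₀⟩ := exists_hasDerivAt_of_continuous hPc
  obtain ⟨y₃, z₃, h₃⟩ := exists_hasDerivAt_of_continuous (hPc.mul continuous_id)
  obtain ⟨y₂, z₂, h₂⟩ := exists_hasDerivAt_of_continuous (hPc.mul (hcont h₃))
  obtain ⟨y₁, z₁, h₁⟩ := exists_hasDerivAt_of_continuous (hPc.mul (hcont h₂))
  -- With x10 = 0 and x4 = t, coordinates 9 down to 5 are successive polynomial primitives.
  -- Coordinates 0 to 3 are never needed explicitly.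
  refine ⟨fun t => ![y₀ t, y₁ t, y₂ t, y₃ t, t, P t, t ^ 2 / 2 + t ^ 3 / 6 + c * t ^ 4 / 24,
    t + t ^ 2 / 2 + c * t ^ 3 / 6, t + c * t ^ 2 / 2, c * t, 0], ?_, fun t => ?_, fun t => rfl⟩
  · ext j
    fin_cases j <;> simp [z₀, z₁, z₂, z₃, hP]
  · rw [hasDerivAt_pi]
    have hq := fun a₁ a₂ a₃ a₄ a₅ => hasDerivAt_quintic a₁ a₂ a₃ a₄ a₅ t
    intro j
    fin_cases j
    · exact h₀ t
    · exact h₁ t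
    · exact h₂ t
    · exact h₃ t
    · exact hasDerivAt_id t
    · exact ((hq 0 0 (1 / 6) (1 / 24) (c / 120)).congr_deriv (by simp [kr₂]; ring)).congr_of_eventuallyEq
        (Filter.Eventually.of_forall fun s => by simp [hP]; ring)
    · exact ((hq 0 (1 / 2) (1 / 6) (c / 24) 0).congr_deriv (by simp [kr₂]; ring)).congr_of_eventuallyEq
        (Filter.Eventually.of_forall fun s => by simp; ring)
    · exact ((hq 1 (1 / 2) (c / 6) 0 0).congr_deriv (by simp [kr₂]; ring)).congr_of_eventuallyEq
        (Filter.Eventually.of_forall fun s => by simp; ring)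
    · exact ((hq 1 (c / 2) 0 0 0).congr_deriv (by simp [kr₂]; ring)).congr_of_eventuallyEq
        (Filter.Eventually.of_forall fun s => by simp; ring)
    · exact ((hq c 0 0 0 0).congr_deriv (by simp [kr₂])).congr_of_eventuallyEq
        (Filter.Eventually.of_forall fun s => by simp)
    · exact hasDerivAt_const t 0

/-- As ∂j f = 0 on U, the derivative ∂j(Qf) equals [∂j, Q]f. This passes independence of coordinates
from f to Qf. -/
theorem fderiv_fderiv_apply_coord {U : Set (Fin 11 → ℝ)} (hU : IsOpen U)
    {f : (Fin 11 → ℝ) → ℝ} (hf : ContDiffOn ℝ ∞ f U) {Q : VF 11} (hQ : ContDiff ℝ ∞ Q)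
    {j : Fin 11} (h : ∀ x ∈ U, fderiv ℝ f x (Pi.single j 1) = 0) {x : Fin 11 → ℝ} (hx : x ∈ U) :
    fderiv ℝ (fun y => fderiv ℝ f y (Q y)) x (Pi.single j 1) =
      fderiv ℝ f x (VectorField.lieBracket ℝ (coordField j) Q x) := by
  have e : (fun y => fderiv ℝ f y (coordField j y)) =ᶠ[𝓝 x] fun _ => 0 :=
    Filter.eventually_of_mem (hU.mem_nhds hx) h
  rw [fderiv_lieBracket_apply hU hf (contDiff_coordField j) hQ hx, e.fderiv_eq]
  simp [coordField]

theorem kr₂_apply_eq_mul (c : ℝ) (x : Fin 11 → ℝ) (j : Fin 11) (hj : (j : ℕ) < 4) :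
    kr₂ c x j = x 5 * flagField c 6 x j := by
  fin_cases j <;> simp at hj <;> simp [kr₂, flagField]

/-! ### An equivalence restricted to the integral curve of κ₂. -/

namespace MapsKr

variable {c c' : ℝ} {φ : VF 11} {U : Set (Fin 11 → ℝ)}

/-- In the coordinates below 4, κ₂ equals x5 K. Functions of these coordinates thus vary along the
curve with a factor x5 = O(t³). -/
theorem fderiv_kr₂_of_coord {g : (Fin 11 → ℝ) → ℝ} {x : Fin 11 → ℝ}
    (h : ∀ j : Fin 11, 4 ≤ (j : ℕ) → fderiv ℝ g x (Pi.single j 1) = 0) :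
    fderiv ℝ g x (kr₂ c x) = x 5 * fderiv ℝ g x (flagField c 6 x) :=
  clm_apply_eq_mul h (kr₂_apply_eq_mul c x)

theorem fderiv_fderiv_zero_coord (h : MapsKr c c' φ U) {j : Fin 11} (hj : 4 ≤ (j : ℕ))
    {x : Fin 11 → ℝ} (hx : x ∈ U) :
    fderiv ℝ (fun y => fderiv ℝ (fun z => φ z 0) y (flagField c 6 y)) x (Pi.single j 1) = 0 := by
  rw [fderiv_fderiv_apply_coord h.isOpen (h.contDiffOn_apply 0) (contDiff_flagField c 6)
    (fun x hx => h.fderiv_zero_coord (by omega) hx) hx, lieBracket_coordField_six c (Fin.le_def.2 hj)]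
  split_ifs
  · exact h.fderiv_zero_coord (by simp) hx
  · simp

theorem fderiv_fderiv_three_coord (h : MapsKr c c' φ U) {j : Fin 11} (hj : 4 ≤ (j : ℕ))
    {x : Fin 11 → ℝ} (hx : x ∈ U) :
    fderiv ℝ (fun y => fderiv ℝ (fun z => φ z 3) y (flagField c 6 y)) x (Pi.single j 1) =
      if j = 4 then fderiv ℝ (fun z => φ z 3) x (coordField 3 x) else 0 := by
  rw [fderiv_fderiv_apply_coord h.isOpen (h.contDiffOn_apply 3) (contDiff_flagField c 6)
    (fun x hx => h.fderiv_three_coord hj hx) hx, lieBracket_coordField_six c (Fin.le_def.2 hj)]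
  split_ifs <;> simp

theorem fderiv_fderiv_three_three_coord (h : MapsKr c c' φ U) {j : Fin 11} (hj : 4 ≤ (j : ℕ))
    {x : Fin 11 → ℝ} (hx : x ∈ U) :
    fderiv ℝ (fun y => fderiv ℝ (fun z => φ z 3) y (coordField 3 y)) x (Pi.single j 1) = 0 := by
  rw [fderiv_fderiv_apply_coord h.isOpen (h.contDiffOn_apply 3) (contDiff_coordField 3)
    (fun x hx => h.fderiv_three_coord hj hx) hx, lieBracket_coordField_coordField]
  simp

/-- Kφ3 varies with x4 through the coefficient x4 of ∂3 in K. Subtracting that part, ∂3φ3 · dx4,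
leaves a covector supported on the coordinates below 4, on which κ₂ acts as x5 K. -/
theorem fderiv_fderiv_three_kr₂ (h : MapsKr c c' φ U) {x : Fin 11 → ℝ} (hx : x ∈ U) :
    fderiv ℝ (fun y => fderiv ℝ (fun z => φ z 3) y (flagField c 6 y)) x (kr₂ c x) =
      fderiv ℝ (fun z => φ z 3) x (coordField 3 x) +
        x 5 * fderiv ℝ (fun y => fderiv ℝ (fun z => φ z 3) y (flagField c 6 y)) x
          (flagField c 6 x) := by
  set b := fderiv ℝ (fun z => φ z 3) x (coordField 3 x)
  set L := fderiv ℝ (fun y => fderiv ℝ (fun z => φ z 3) y (flagField c 6 y)) x with hL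
  have := clm_apply_eq_mul (L := L - b • ContinuousLinearMap.proj 4) (m := 4) (fun j hj => by
    rw [sub_apply, hL, h.fderiv_fderiv_three_coord hj hx]
    split_ifs with h4
    · simp [h4, b]
    · simp [Ne.symm h4]) (kr₂_apply_eq_mul c x)
  simp [kr₂, flagField] at this
  simp [kr₂, flagField]
  linarith

open Asymptotics in
theorem parameter_eq (h : MapsKr c c' φ U) (h0 : 0 ∈ U) (hφ : φ 0 = 0) : c = c' := by
  obtain ⟨γ, hγ0, hγ, hγ5⟩ := exists_integralCurve c
  have hγU : ∀ᶠ t in 𝓝 0, γ t ∈ U :=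
    (hγ 0).continuousAt.eventually_mem (by rw [hγ0]; exact h.isOpen.mem_nhds h0)
  have hD : ∀ {g : (Fin 11 → ℝ) → ℝ}, ContDiffOn ℝ ∞ g U → ∀ {t : ℝ}, γ t ∈ U →
      HasDerivAt (fun s => g (γ s)) (fderiv ℝ g (γ t) (kr₂ c (γ t))) t := fun hg t ht =>
    ((hg.contDiffAt (h.isOpen.mem_nhds ht)).differentiableAt
      (by simp)).hasFDerivAt.comp_hasDerivAt t (hγ t)
  have hC : ∀ {g : (Fin 11 → ℝ) → ℝ}, ContDiffOn ℝ ∞ g U → ContinuousAt (fun s => g (γ s)) 0 :=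
    fun hg => (hD hg (by rw [hγ0]; exact h0)).continuousAt
  have hF := h.contDiffOn_apply
  have hκ : ∀ x, kr₂ c x ∈ derivedDist (krDist c) 0 x := fun x => by
    rw [derivedDist_krDist_zero]
    exact Submodule.subset_span (Or.inr rfl)
  have hrel := fun (r : ℕ) (hr : r ≤ 8) {t : ℝ} (ht : γ t ∈ U) =>
    h.pfaff_of_mem_derivedDist (by norm_num) ht (hκ (γ t)) (Nat.zero_le r) hr
  set δ : ℝ → ℝ := fun t => fderiv ℝ (fun y => φ y 4) (γ t) (kr₂ c (γ t)) with hδ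
  set P : ℝ → ℝ := fun t => t ^ 3 / 6 + t ^ 4 / 24 + c * t ^ 5 / 120 with hP
  have hK := contDiff_flagField c 6
  have sG := contDiffOn_fderiv_apply h.isOpen (hF 0) hK
  have sH := contDiffOn_fderiv_apply h.isOpen (hF 3) hK
  have sB := contDiffOn_fderiv_apply h.isOpen (hF 3) (contDiff_coordField 3)
  have cG1 := hC (contDiffOn_fderiv_apply h.isOpen sG hK)
  have cH1 := hC (contDiffOn_fderiv_apply h.isOpen sH hK)
  have cB1 := hC (contDiffOn_fderiv_apply h.isOpen sB hK)
  set G : ℝ → ℝ := fun t => fderiv ℝ (fun z => φ z 0) (γ t) (flagField c 6 (γ t)) with hG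
  set B : ℝ → ℝ := fun t => fderiv ℝ (fun z => φ z 3) (γ t) (coordField 3 (γ t)) with hB
  set G1 : ℝ → ℝ := fun t => fderiv ℝ (fun y => fderiv ℝ (fun z => φ z 0) y (flagField c 6 y))
    (γ t) (flagField c 6 (γ t)) with hG1
  set H1 : ℝ → ℝ := fun t => fderiv ℝ (fun y => fderiv ℝ (fun z => φ z 3) y (flagField c 6 y))
    (γ t) (flagField c 6 (γ t)) with hH1
  set B1 : ℝ → ℝ := fun t => fderiv ℝ (fun y => fderiv ℝ (fun z => φ z 3) y (coordField 3 y))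
    (γ t) (flagField c 6 (γ t)) with hB1
  have hG0 : G 0 ≠ 0 := by
    have := h.fderiv_zero_six_ne_zero h0
    simpa only [hG, hγ0] using this
  have dG : ∀ {t}, γ t ∈ U → HasDerivAt G (P t * G1 t) t := fun {t} ht => by
    have := hD sG ht
    rw [fderiv_kr₂_of_coord fun j hj => h.fderiv_fderiv_zero_coord hj ht, hγ5] at this
    exact this
  have dB : ∀ {t}, γ t ∈ U → HasDerivAt B (P t * B1 t) t := fun {t} ht => by
    have := hD sB ht
    rw [fderiv_kr₂_of_coord fun j hj => h.fderiv_fderiv_three_three_coord hj ht, hγ5] at this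
    exact this
  have hO : ∀ {f : ℝ → ℝ}, ContinuousAt f 0 → (fun t => P t * f t) =O[𝓝 0] fun t => t ^ 3 := by
    intro f hf
    have hc : ContinuousAt (fun t : ℝ => (1 / 6 + t / 24 + c * t ^ 2 / 120) * f t) 0 :=
      ContinuousAt.mul (by fun_prop) hf
    refine (isBigO_pow_mul_of_le hc le_rfl).congr_left fun t => ?_
    simp only [hP]
    ring
  have hO1 : ∀ {f f' : ℝ → ℝ}, (∀ {t}, γ t ∈ U → HasDerivAt f (P t * f' t) t) →
      ContinuousAt f' 0 → (fun t => f t - f 0) =O[𝓝 0] fun t => t ^ 3 := by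
    intro f f' hf hf'
    have h4 := isBigO_pow_succ_of_hasDerivAt (f := fun t => f t - f 0)
      (hγU.mono fun t ht => (hf ht).sub_const (f 0)) (sub_self _) (hO hf')
    refine h4.trans ?_
    simpa using isBigO_pow_mul_of_le (r := fun _ => 1) continuousAt_const (show 3 ≤ 3 + 1 by norm_num)
  have oG := hO1 dG cG1
  have oB := hO1 dB cB1
  -- The derivative along the curve of Kφ3 = φ4 · Kφ0, the pulled-back equation of index 6 evaluated
  -- on K.
  have key : ∀ᶠ t in 𝓝 0, δ t * G t + φ (γ t) 4 * (P t * G1 t) = B t + P t * H1 t := by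
    filter_upwards [hγU.eventually_nhds] with t ht
    have e1 : (fun s => fderiv ℝ (fun z => φ z 3) (γ s) (flagField c 6 (γ s))) =ᶠ[𝓝 t]
        fun s => φ (γ s) 4 * G s := ht.mono fun s hs => by
      have := h.pfaff_of_mem_derivedDist (r := 6) (by norm_num) hs
        (flagGens_apply_mem c (by norm_num) (Set.mem_insert _ _) (γ s)) le_rfl (by norm_num)
      simpa [pfaffTarget, pfaffSource, pfaffConst] using this
    have htU := ht.self_of_nhds
    have e2 := (((hD (hF 4) htU).mul (dG htU)).congr_of_eventuallyEq e1).unique (hD sH htU)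
    rw [h.fderiv_fderiv_three_kr₂ htU, hγ5] at e2
    exact e2
  -- Solving for δ: the P terms are O(t³), and B and G are constant up to O(t³), with G(0) ≠ 0.
  have oδ : (fun t => δ t - B 0 / G 0) =O[𝓝 0] fun t => t ^ 3 := by
    have cG : ContinuousAt G 0 := hC sG
    have o1 := (oB.add (hO cH1)).sub ((hO (cG1.mul (hC (hF 4)))).add (oG.const_mul_left (B 0 / G 0)))
    have o2 := o1.mul ((cG.inv₀ hG0).isBigO_one ℝ)
    refine (o2.congr_right fun t => mul_one _).congr' ?_ Filter.EventuallyEq.rfl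
    filter_upwards [key, cG.eventually_ne hG0] with t ht htG
    simp only [Pi.inv_apply, Pi.mul_apply]
    field_simp
    linear_combination (-G 0) * ht
  have hr : ∀ (r : ℕ) (hr : r ≤ 5), ∀ᶠ t in 𝓝 0, HasDerivAt (fun s => φ (γ s) (pfaffTarget r))
      ((φ (γ t) ⟨10 - r, by omega⟩ + pfaffConst c' r) * δ t) t := fun r hr =>
    hγU.mono fun t ht => by
      have := hD (hF (pfaffTarget r)) ht
      rw [hrel r (by omega) ht] at this
      simpa only [pfaffSource, hr, if_true] using this
  have z : ∀ m, φ (γ 0) m = 0 := fun m => by rw [hγ0, hφ]; rfl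
  refine parameter_eq_of_tower (c := c) (c' := c') (f₅ := fun t => φ (γ t) 5)
    (f₆ := fun t => φ (γ t) 6) (f₇ := fun t => φ (γ t) 7) (f₈ := fun t => φ (γ t) 8)
    (f₉ := fun t => φ (γ t) 9) (f₁₀ := fun t => φ (γ t) 10) ?_ ?_ ?_ ?_ ?_ ?_
    (z 5) (z 6) (z 7) (z 8) (z 9) (z 10) oδ oG hG0 ?_
  · simpa [pfaffTarget, pfaffConst] using! hr 4 (by norm_num)
  · simpa [pfaffTarget, pfaffConst] using! hr 3 (by norm_num)
  · exact hr 2 (by norm_num)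
  · exact hr 1 (by norm_num)
  · exact hr 0 (by norm_num)
  · exact (hD (hF 10) (by rw [hγ0]; exact h0)).differentiableAt
  -- The derivative of φ0 along the curve in two ways: φ5 δ by the equation of index 5, and x5 · Kφ0
  -- because φ0 does not depend on the coordinates from 3 on.
  · filter_upwards [hγU] with t ht
    have e1 := hrel 5 (by norm_num) ht
    have e2 := fderiv_kr₂_of_coord (c := c) fun j hj => h.fderiv_zero_coord (by omega) ht (j := j)
    rw [hγ5] at e2
    simp [pfaffTarget, pfaffSource, pfaffConst] at e1
    rw [← e1]
    exact e2

end MapsKr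

theorem locallyEquivalent_krDist_iff (c c' : ℝ) :
    LocallyEquivalent (krDist c) 0 (krDist c') 0 ↔ c = c' := by
  constructor
  · rintro ⟨φ, h0, hφ0, hφ, hφ', hmap⟩
    refine MapsKr.parameter_eq (φ := φ) (U := φ.source) ⟨φ.open_source, hφ, fun x hx => ?_,
      fun x hx v hv => ?_⟩ h0 hφ0
    · have h1 : HasFDerivAt φ (fderiv ℝ φ x) x :=
        ((hφ.contDiffAt (φ.open_source.mem_nhds hx)).differentiableAt (by simp)).hasFDerivAt
      have h2 : HasFDerivAt φ.symm (fderiv ℝ φ.symm (φ x)) (φ x) :=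
        ((hφ'.contDiffAt (φ.open_target.mem_nhds (φ.map_source hx))).differentiableAt
          (by simp)).hasFDerivAt
      have e : φ.symm ∘ φ =ᶠ[𝓝 x] id :=
        Filter.eventually_of_mem (φ.open_source.mem_nhds hx) fun y hy => φ.left_inv hy
      have h3 := (h2.comp x h1).unique ((hasFDerivAt_id x).congr_of_eventuallyEq e)
      intro v w hvw
      have := congrArg (fderiv ℝ φ.symm (φ x)) hvw
      rw [← ContinuousLinearMap.comp_apply, ← ContinuousLinearMap.comp_apply, h3] at this
      exact this
    · rw [← hmap x hx]
      exact ⟨v, hv, rfl⟩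
  · rintro rfl
    refine ⟨OpenPartialHomeomorph.refl _, by simp, by simp, contDiffOn_id, contDiffOn_id,
      fun x _ => ?_⟩
    change (krDist c x).map (fderiv ℝ id x : (Fin 11 → ℝ) →ₗ[ℝ] (Fin 11 → ℝ)) = krDist c x
    rw [fderiv_id]
    exact Submodule.map_id _

end Goursat

theorem mainTheorem9 :
    (∀ c : ℝ, Goursat.IsKumperaRuiz 11 Goursat.kr₁ (Goursat.kr₂ c) ∧
      Goursat.IsGoursat (Goursat.krDist c)) ∧
    (∀ c c' : ℝ,
      Goursat.LocallyEquivalent (Goursat.krDist c) 0 (Goursat.krDist c') 0 ↔ c = c') ∧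
    (∀ c : ℝ, Goursat.singularityType (Goursat.krDist c) 0 = [0, 0, 1, 2, 3, 0, 0, 0]) ∧
    (∀ c c' : ℝ,
      Goursat.growthVector (Goursat.krDist c) 0 = Goursat.growthVector (Goursat.krDist c') 0) ∧
    (∀ c c' : ℝ, Goursat.SameAbnormals (Goursat.krDist c) 0 (Goursat.krDist c') 0) := by
  exact ⟨fun c => ⟨Goursat.isKumperaRuiz_kr c, Goursat.isGoursat_krDist c⟩,
    Goursat.locallyEquivalent_krDist_iff, Goursat.singularityType_krDist,
    fun c c' => funext fun i => by rw [Goursat.growthVector_krDist, Goursat.growthVector_krDist],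
    Goursat.sameAbnormals_krDist⟩
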